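/- Let $n\ge 1$, let $b_1,\dots,b_n$ be a basis of $\mathbb{R}^n$, let $\Lambda=\mathbb{Z}b_1+\dots+\mathbb{Z}b_n$, and let $T^n=\mathbb{R}^n/\Lambda$ be the flat torus with the metric induced by the standard metric of $\mathbb{R}^n$. Let $\Lambda^*=\{l\in(\mathbb{R}^n)^*\mid l(v)\in\mathbb{Z}\text{ for all }v\in\Lambda\}$ be the dual lattice, with the Euclidean norm $|\cdot|$ on $(\mathbb{R}^n)^*$. Let $\alpha,\beta>0$ and $1\le p\le n$. Let $d$ be the exterior derivative, $\delta$ its formal adjoint with respect to the $L^2$-scalar product of forms, and let $$F=\alpha\, d\delta+\beta\,\delta d$$ act on the space $\Omega^p(T^n,\mathbb{C})$ of smooth complex-valued $p$-forms. For $z\in\mathbb{C}$ let $\mathrm{Eig}(F,z)=\{\omega\in\Omega^p(T^n,\mathbb{C})\mid F\omega=z\omega\}$. The spectrum of $F$ is the weighted set (function $\mathbb{C}\to\mathbb{N}_0$) $\mathrm{Spec}(F)(z)=\dim_{\mathbb{C}}\mathrm{Eig}(F,z)$. The weighted union $\Cup$ of weighted sets is the pointwise sum, and $\{x\}_m$ is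 the weighted set that takes the value $m$ at $x$ and $0$ elsewhere. For $l\in\Lambda^*$ and $\gamma\in\mathbb{R}$ put $\lambda^l_\gamma=4\pi^2\gamma|l|^2$ and $\chi_l([x])=e^{2\pi i\, l(x)}$, let $l^\sharp\in\mathbb{R}^n$ be the vector with $\langle l^\sharp,\cdot\rangle=l$, and put $$V_l^p=\chi_l\cdot\{\,l\wedge\eta\mid\eta\text{ a parallel complex }(p-1)\text{-form}\,\},\qquad W_l^p=\chi_l\cdot\{\,\omega\text{ a parallel complex }p\text{-form}\mid l^\sharp\lrcorner\,\omega=0\,\},$$ where parallel forms are the forms with constant coefficients. Then only finitely many $l\in\Lambda^*$ have any given norm, all spaces $\mathrm{Eig}(F,z)$ are finite-dimensional, $$\mathrm{Spec}(F)=\Bigl(\mathop{\Cup}_{l\in\Lambda^*}\{\lambda^l_\alpha\}_{\binom{n-1}{p-1}}\Bigr)\Cup\Bigl(\mathop{\Cup}_{l\in\Lambda^*}\{\lambda^l_\beta\}_{\binom{n-1}{p}}\Bigr)$$ (with $\binom{n-1}{n}=0$), and for every real $z$ the eigenspace of $F$ to $z$ on the real-valued smooth $p$-forms is finite-dimensional,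 its real dimension being also $\mathrm{Spec}(F)(z)$. Moreover, for every $k\in\Lambda^*$, $$\mathrm{Eig}(F,\lambda^k_\alpha)=\bigoplus_{l\in\Lambda^*,\ |l|=|k|}V_l^p\ \oplus\bigoplus_{l\in\Lambda^*,\ |l|=\sqrt{\alpha/\beta}\,|k|}W_l^p$$ and $$\mathrm{Eig}(F,\lambda^k_\beta)=\bigoplus_{l\in\Lambda^*,\ |l|=\sqrt{\beta/\alpha}\,|k|}V_l^p\ \oplus\bigoplus_{l\in\Lambda^*,\ |l|=|k|}W_l^p .$$ -/

import Mathlib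

open MeasureTheory

namespace FlatTorus

/-- Euclidean space `ℝⁿ`. -/
abbrev Space (n : ℕ) : Type := EuclideanSpace ℝ (Fin n)

/-- The standard orthonormal basis vectors of `ℝⁿ`. -/
noncomputable abbrev stdVec {n : ℕ} (i : Fin n) : Space n := EuclideanSpace.single i (1 : ℝ)

/-- The space of alternating `p`-forms on `ℝⁿ` with values in `𝕜`, where `𝕜` is `ℝ` or `ℂ`. -/
abbrev Alt (𝕜 : Type) [RCLike 𝕜] (n p : ℕ) : Type := Space n [⋀^Fin p]→L[ℝ] 𝕜

/-- The lattice `ℤ b₁ + ... + ℤ bₙ` induced by a basis `b` of `ℝⁿ`. -/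
abbrev lattice {n : ℕ} (b : Module.Basis (Fin n) ℝ (Space n)) : Submodule ℤ (Space n) :=
  Submodule.span ℤ (Set.range b)

/-- The torus `ℝⁿ / Λ`. -/
abbrev Torus {n : ℕ} (b : Module.Basis (Fin n) ℝ (Space n)) : Type := Space n ⧸ lattice b

/-- The canonical projection `ℝⁿ → ℝⁿ / Λ`. -/
abbrev proj {n : ℕ} (b : Module.Basis (Fin n) ℝ (Space n)) (x : Space n) : Torus b :=
  Submodule.Quotient.mk x

/-- The dual lattice `{l ∈ (ℝⁿ)* | l(v) ∈ ℤ for all v ∈ Λ}`. The norm of a linear form is the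
operator norm, i.e. the Euclidean norm on `(ℝⁿ)*`. -/
def dualLattice {n : ℕ} (b : Module.Basis (Fin n) ℝ (Space n)) :
    AddSubgroup (Space n →L[ℝ] ℝ) where
  carrier := {l | ∀ v ∈ lattice b, ∃ m : ℤ, l v = m}
  zero_mem' := fun _ _ => ⟨0, by simp⟩
  add_mem' := by
    intro l l' hl hl' v hv
    obtain ⟨m, hm⟩ := hl v hv
    obtain ⟨m', hm'⟩ := hl' v hv
    exact ⟨m + m', by simp [hm, hm']⟩
  neg_mem' := by
    intro l hl v hv
    obtain ⟨m, hm⟩ := hl v hv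
    exact ⟨-m, by simp [hm]⟩

/-- Smooth `𝕜`-valued differential `p`-forms on the torus `ℝⁿ / Λ`. Every tangent space of the torus
is identified with `ℝⁿ` through the differential of the projection, so that a `p`-form is a map from
the torus to the alternating `p`-forms on `ℝⁿ`; it is smooth if its pull-back to `ℝⁿ` is. -/
def smoothForms (𝕜 : Type) [RCLike 𝕜] {n : ℕ} (b : Module.Basis (Fin n) ℝ (Space n)) (p : ℕ) :
    Submodule 𝕜 (Torus b → Alt 𝕜 n p) where
  carrier := {ω | ContDiff ℝ (⊤ : ℕ∞) (fun x : Space n => ω (proj b x))}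
  zero_mem' := by
    rw [Set.mem_ofPred_eq]
    exact contDiff_const
  add_mem' := by
    intro ω η h h'
    rw [Set.mem_ofPred_eq] at *
    exact h.add h'
  smul_mem' := by
    intro c ω h
    rw [Set.mem_ofPred_eq] at *
    exact h.const_smul c

/-- The space `Ωᵖ` of smooth `𝕜`-valued differential `p`-forms on the torus. -/
def Form (𝕜 : Type) [RCLike 𝕜] {n : ℕ} (b : Module.Basis (Fin n) ℝ (Space n)) (p : ℕ) : Type :=
  smoothForms 𝕜 b p

noncomputable instance (𝕜 : Type) [RCLike 𝕜] {n : ℕ} (b : Module.Basis (Fin n) ℝ (Space n))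
    (p : ℕ) : AddCommGroup (Form 𝕜 b p) :=
  inferInstanceAs (AddCommGroup (smoothForms 𝕜 b p))

noncomputable instance (𝕜 : Type) [RCLike 𝕜] {n : ℕ} (b : Module.Basis (Fin n) ℝ (Space n))
    (p : ℕ) : Module 𝕜 (Form 𝕜 b p) :=
  inferInstanceAs (Module 𝕜 (smoothForms 𝕜 b p))

section Basic

variable {𝕜 : Type} [RCLike 𝕜] {n : ℕ} {b : Module.Basis (Fin n) ℝ (Space n)} {p : ℕ}

/-- The pull-back of a form along the projection `ℝⁿ → ℝⁿ / Λ`. -/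
def pull (ω : Form 𝕜 b p) (x : Space n) : Alt 𝕜 n p := ω.1 (proj b x)

theorem contDiff_pull (ω : Form 𝕜 b p) : ContDiff ℝ (⊤ : ℕ∞) (pull ω) := ω.2

theorem pull_add_mem (ω : Form 𝕜 b p) (x : Space n) {v : Space n} (hv : v ∈ lattice b) :
    pull ω (x + v) = pull ω x := by
  have : proj b (x + v) = proj b x := by
    rw [proj, proj, Submodule.Quotient.eq]
    simpa using hv
  rw [pull, pull, this]

@[ext]
theorem form_ext {ω η : Form 𝕜 b p} (h : ∀ x, pull ω x = pull η x) : ω = η := by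
  apply Subtype.ext
  funext t
  obtain ⟨x, rfl⟩ := Submodule.Quotient.mk_surjective _ t
  exact h x

theorem pull_add (ω η : Form 𝕜 b p) : pull (ω + η) = pull ω + pull η := rfl

theorem pull_smul (c : 𝕜) (ω : Form 𝕜 b p) : pull (c • ω) = c • pull ω := rfl

/-- The smooth form on the torus whose pull-back to `ℝⁿ` is a given periodic smooth form. -/
def ofPeriodic (f : Space n → Alt 𝕜 n p) (hf : ContDiff ℝ (⊤ : ℕ∞) f)
    (hper : ∀ x, ∀ v ∈ lattice b, f (x + v) = f x) : Form 𝕜 b p :=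
  ⟨fun t => Quotient.liftOn' t f (fun x y hxy => by
      have h := (Submodule.quotientRel_def _).1 hxy
      have := hper y _ h
      rwa [add_sub_cancel] at this), hf⟩

@[simp]
theorem pull_ofPeriodic (f : Space n → Alt 𝕜 n p) (hf : ContDiff ℝ (⊤ : ℕ∞) f)
    (hper : ∀ x, ∀ v ∈ lattice b, f (x + v) = f x) : pull (ofPeriodic f hf hper) = f := rfl

theorem fderiv_pull_add_mem (ω : Form 𝕜 b p) (x : Space n) {v : Space n}
    (hv : v ∈ lattice b) : fderiv ℝ (pull ω) (x + v) = fderiv ℝ (pull ω) x := by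
  rw [← fderiv_comp_add_right]
  congr 1
  funext y
  exact pull_add_mem ω y hv

theorem contDiff_fderiv_pull (ω : Form 𝕜 b p) :
    ContDiff ℝ (⊤ : ℕ∞) (fderiv ℝ (pull ω)) :=
  (contDiff_pull ω).fderiv_right (m := (⊤ : ℕ∞)) (by simp)

theorem contDiff_extDeriv_pull (ω : Form 𝕜 b p) :
    ContDiff ℝ (⊤ : ℕ∞) (extDeriv (pull ω)) := by
  have h := (ContinuousAlternatingMap.alternatizeUncurryFinCLM ℝ (Space n) 𝕜 (n := p)).contDiff
    (n := (⊤ : ℕ∞)) |>.comp (contDiff_fderiv_pull ω)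
  exact h

/-- The exterior derivative on the torus; in the identification of forms with their pull-backs it is
the exterior derivative on `ℝⁿ`. -/
noncomputable def extD : Form 𝕜 b p →ₗ[𝕜] Form 𝕜 b (p + 1) where
  toFun ω := ofPeriodic (extDeriv (pull ω))
    (contDiff_extDeriv_pull ω)
    (fun x v hv => by rw [extDeriv, extDeriv, fderiv_pull_add_mem ω x hv])
  map_add' ω η := by
    ext1 x
    exact extDeriv_add ((contDiff_pull ω).differentiable (by simp) x)
      ((contDiff_pull η).differentiable (by simp) x)
  map_smul' c ω := by
    ext1 x
    change extDeriv (c • pull ω) x = c • extDeriv (pull ω) x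
    rw [extDeriv, extDeriv, fderiv_const_smul_field, Pi.smul_apply,
      ContinuousAlternatingMap.alternatizeUncurryFin_smul]

theorem pull_extD (ω : Form 𝕜 b p) : pull (extD ω) = extDeriv (pull ω) := rfl

/-- The scalar product on alternating `p`-forms for which the forms
`e^{i₁} ∧ ... ∧ e^{i_p}`, `i₁ < ... < i_p`, are orthonormal. It is written as the sum over all
`p`-tuples of indices divided by `p!`. -/
noncomputable def altInner (φ ψ : Alt 𝕜 n p) : 𝕜 :=
  ((p.factorial : 𝕜))⁻¹ * ∑ I : Fin p → Fin n,
    inner 𝕜 (φ fun j => stdVec (I j)) (ψ fun j => stdVec (I j))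

/-- The `L²`-scalar product of forms on the torus with respect to the Riemannian volume. The integral
over the torus is the integral over the fundamental parallelotope
`{∑ tᵢ bᵢ | 0 ≤ tᵢ < 1}` of the lattice. -/
noncomputable def l2Inner (ω η : Form 𝕜 b p) : 𝕜 :=
  ∫ x in ZSpan.fundamentalDomain b, altInner (ω.1 (proj b x)) (η.1 (proj b x))

/-- `δ` is a formal adjoint of the exterior derivative on `p`-forms. -/
def IsFormalAdjoint (δ : Form 𝕜 b (p + 1) →ₗ[𝕜] Form 𝕜 b p) : Prop :=
  ∀ (ω : Form 𝕜 b p) (η : Form 𝕜 b (p + 1)), l2Inner (extD ω) η = l2Inner ω (δ η)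

theorem integrableOn_fundamentalDomain {F : Type} [NormedAddCommGroup F] [NormedSpace ℝ F]
    (f : Space n → F) (hf : Continuous f) (b : Module.Basis (Fin n) ℝ (Space n)) :
    IntegrableOn f (ZSpan.fundamentalDomain b) := by
  have hb := (ZSpan.fundamentalDomain_isBounded b).isCompact_closure
  exact (hf.continuousOn.integrableOn_compact hb).mono_set subset_closure

open scoped Pointwise in
theorem integral_translate (g : Space n → 𝕜) (b : Module.Basis (Fin n) ℝ (Space n))
    (hper : ∀ x, ∀ v ∈ lattice b, g (x + v) = g x) (w : Space n) :
    ∫ x in ZSpan.fundamentalDomain b, g (x + w) = ∫ x in ZSpan.fundamentalDomain b, g x := by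
  have : Countable (lattice b).toAddSubgroup := inferInstanceAs (Countable (lattice b))
  have h1 := ZSpan.isAddFundamentalDomain' b (volume : Measure (Space n))
  have h2 : IsAddFundamentalDomain (lattice b).toAddSubgroup (w +ᵥ ZSpan.fundamentalDomain b)
      (volume : Measure (Space n)) := h1.vadd_of_comm w
  have h3 := h1.setIntegral_eq h2 (f := g) (fun v x => by
    rw [AddSubgroup.vadd_def, vadd_eq_add, add_comm]; exact hper x v v.2)
  rw [h3]
  have hmp : MeasurePreserving (fun x : Space n => w + x) volume volume :=
    measurePreserving_add_left volume w
  have := hmp.setIntegral_image_emb (measurableEmbedding_addLeft w) g (ZSpan.fundamentalDomain b)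
  rw [show w +ᵥ ZSpan.fundamentalDomain b = (fun x => w + x) '' ZSpan.fundamentalDomain b from rfl,
    this]
  simp only [add_comm]

theorem bounded_of_periodic {F : Type} [NormedAddCommGroup F] (f : Space n → F)
    (hf : Continuous f) (b : Module.Basis (Fin n) ℝ (Space n))
    (hper : ∀ x, ∀ v ∈ lattice b, f (x + v) = f x) : ∃ C, ∀ x, ‖f x‖ ≤ C := by
  have := IsZLattice.isCompact_range_of_periodic (lattice b) f hf hper
  obtain ⟨C, hC⟩ := this.isBounded.exists_norm_le
  exact ⟨C, fun x => hC _ ⟨x, rfl⟩⟩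

theorem integral_fderiv_eq_zero (g : Space n → 𝕜) (hg : ContDiff ℝ (⊤ : ℕ∞) g)
    (b : Module.Basis (Fin n) ℝ (Space n))
    (hper : ∀ x, ∀ v ∈ lattice b, g (x + v) = g x) (w : Space n) :
    ∫ x in ZSpan.fundamentalDomain b, fderiv ℝ g x w = 0 := by
  have hc : Continuous (fun x => fderiv ℝ g x w) :=
    (hg.continuous_fderiv (by simp)).clm_apply continuous_const
  obtain ⟨C, hC⟩ := bounded_of_periodic (fun x => fderiv ℝ g x w) hc b (fun x v hv => by
    have : fderiv ℝ g (x + v) = fderiv ℝ g x := by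
      rw [← fderiv_comp_add_right]
      congr 1
      funext y
      exact hper y v hv
    simp only [this])
  have hline : ∀ (x : Space n) (t : ℝ), Continuous (fun x : Space n => x + t • w) :=
    fun x t => by fun_prop
  have key := hasDerivAt_integral_of_dominated_loc_of_deriv_le
    (μ := volume.restrict (ZSpan.fundamentalDomain b)) (s := Set.univ)
    (F := fun (t : ℝ) (x : Space n) => g (x + t • w))
    (F' := fun (t : ℝ) (x : Space n) => fderiv ℝ g (x + t • w) w) (x₀ := 0)
    (bound := fun _ => C) Filter.univ_mem
    (Filter.Eventually.of_forall fun t =>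
      (hg.continuous.comp (hline 0 t)).aestronglyMeasurable)
    (integrableOn_fundamentalDomain _ (hg.continuous.comp (hline 0 0)) b)
    ((hc.comp (hline 0 0)).aestronglyMeasurable)
    (Filter.Eventually.of_forall fun x t _ => hC _)
    (integrableOn_fundamentalDomain _ continuous_const b)
    (Filter.Eventually.of_forall fun x t _ => by
      have h1 : HasDerivAt (fun t : ℝ => x + t • w) w t := by
        simpa using ((hasDerivAt_id t).smul_const w).const_add x
      exact ((hg.differentiable (by simp) _).hasFDerivAt.comp_hasDerivAt t h1))
  have h2 := key.2
  simp only [integral_translate g b hper, zero_smul, add_zero] at h2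
  exact h2.unique (hasDerivAt_const _ _)

theorem pull_apply_contDiff (ω : Form 𝕜 b p) (v : Fin p → Space n) :
    ContDiff ℝ (⊤ : ℕ∞) (fun x => pull ω x v) :=
  (ContinuousAlternatingMap.apply ℝ (Space n) 𝕜 v).contDiff.comp (contDiff_pull ω)


theorem altInner_alternatizeUncurryFin (f : Space n →L[ℝ] Alt 𝕜 n p) (ψ : Alt 𝕜 n (p + 1)) :
    altInner (ContinuousAlternatingMap.alternatizeUncurryFin f) ψ =
      ∑ i : Fin n, altInner (f (stdVec i)) (ψ.curryLeft (stdVec i)) := by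
  have key : ∀ k : Fin (p + 1),
      ∑ J : Fin (p + 1) → Fin n,
        inner 𝕜 ((-1 : ℤ) ^ (k : ℕ) • f (stdVec (J k)) (k.removeNth fun j => stdVec (J j)))
          (ψ fun j => stdVec (J j)) =
      ∑ i : Fin n, ∑ I : Fin p → Fin n,
        inner 𝕜 (f (stdVec i) fun j => stdVec (I j))
          (ψ.curryLeft (stdVec i) fun j => stdVec (I j)) := by
    intro k
    rw [← (Fin.insertNthEquiv (fun _ => Fin n) k).sum_comp, Fintype.sum_prod_type]
    refine Finset.sum_congr rfl fun i _ => Finset.sum_congr rfl fun I _ => ?_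
    have h1 : (fun j => (stdVec ((Fin.insertNthEquiv (fun _ => Fin n) k (i, I)) j) : Space n)) =
        k.insertNth (stdVec i) (fun j => stdVec (I j)) := by
      funext j
      refine Fin.succAboveCases k ?_ (fun j => ?_) j <;> simp
    rw [h1, ContinuousAlternatingMap.map_insertNth, Fin.removeNth_insertNth,
      ContinuousAlternatingMap.curryLeft_apply_apply]
    have h2 : (Fin.insertNthEquiv (fun _ => Fin n) k (i, I)) k = i := by simp
    rw [h2]
    rcases neg_one_pow_eq_or ℤ (k : ℕ) with h | h <;> rw [h] <;> simp
  have hp : ((p + 1 : ℕ) : 𝕜) ≠ 0 := Nat.cast_ne_zero.2 (Nat.succ_ne_zero p)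
  have hp' : ((p.factorial : ℕ) : 𝕜) ≠ 0 := Nat.cast_ne_zero.2 (Nat.factorial_ne_zero p)
  simp only [altInner, ContinuousAlternatingMap.alternatizeUncurryFin_apply, sum_inner]
  rw [Finset.sum_comm, Finset.sum_congr rfl fun k _ => key k, ← Finset.mul_sum, Finset.sum_const,
    Finset.card_univ, Fintype.card_fin, nsmul_eq_mul, Nat.factorial_succ, Nat.cast_mul]
  field_simp

theorem altInner_neg_right (φ ψ : Alt 𝕜 n p) : altInner φ (-ψ) = -altInner φ ψ := by
  simp [altInner]

theorem altInner_sum_right {ι : Type} (s : Finset ι) (φ : Alt 𝕜 n p) (ψ : ι → Alt 𝕜 n p) :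
    altInner φ (∑ i ∈ s, ψ i) = ∑ i ∈ s, altInner φ (ψ i) := by
  simp only [altInner, ContinuousAlternatingMap.sum_apply, inner_sum]
  rw [Finset.sum_comm, Finset.mul_sum]

theorem contDiff_altInner {f g : Space n → Alt 𝕜 n p} (hf : ContDiff ℝ (⊤ : ℕ∞) f)
    (hg : ContDiff ℝ (⊤ : ℕ∞) g) : ContDiff ℝ (⊤ : ℕ∞) (fun x => altInner (f x) (g x)) := by
  refine contDiff_const.mul (ContDiff.sum fun I _ => ContDiff.inner 𝕜 ?_ ?_)
  · exact (ContinuousAlternatingMap.apply ℝ (Space n) 𝕜 _).contDiff.comp hf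
  · exact (ContinuousAlternatingMap.apply ℝ (Space n) 𝕜 _).contDiff.comp hg

theorem fderiv_altInner {f g : Space n → Alt 𝕜 n p} (hf : ContDiff ℝ (⊤ : ℕ∞) f)
    (hg : ContDiff ℝ (⊤ : ℕ∞) g) (x w : Space n) :
    fderiv ℝ (fun x => altInner (f x) (g x)) x w =
      altInner (fderiv ℝ f x w) (g x) + altInner (f x) (fderiv ℝ g x w) := by
  have happ : ∀ (h : Space n → Alt 𝕜 n p), ContDiff ℝ (⊤ : ℕ∞) h → ∀ v : Fin p → Space n,
      HasFDerivAt (fun x => h x v)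
        ((ContinuousAlternatingMap.apply ℝ (Space n) 𝕜 v).comp (fderiv ℝ h x)) x :=
    fun h hh v => (ContinuousAlternatingMap.apply ℝ (Space n) 𝕜 v).hasFDerivAt.comp x
      (hh.differentiable (by simp) x).hasFDerivAt
  have h1 := (HasFDerivAt.fun_sum (u := Finset.univ) fun (I : Fin p → Fin n) _ =>
    (happ f hf fun j => stdVec (I j)).inner 𝕜 (happ g hg fun j => stdVec (I j))).const_mul
      ((p.factorial : 𝕜)⁻¹)
  have h2 : HasFDerivAt (fun x => altInner (f x) (g x)) _ x := h1
  rw [h2.fderiv]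
  simp [altInner, Finset.sum_add_distrib, mul_add, add_comm]

/-- The operator `- ∑ᵢ eᵢ ⌟ ∂ᵢ`. -/
noncomputable def divFun (η : Form 𝕜 b (p + 1)) (x : Space n) : Alt 𝕜 n p :=
  -∑ i : Fin n, (fderiv ℝ (pull η) x (stdVec i)).curryLeft (stdVec i)

/-- Contraction of alternating forms with a fixed vector. -/
noncomputable def contractCLM (v : Space n) : Alt 𝕜 n (p + 1) →L[ℝ] Alt 𝕜 n p :=
  (ContinuousLinearMap.apply ℝ (Alt 𝕜 n p) v).comp
    (ContinuousAlternatingMap.curryLeftLI (𝕜 := ℝ) (E := Space n) (F := 𝕜)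
      (n := p)).toContinuousLinearMap

theorem contractCLM_apply (v : Space n) (φ : Alt 𝕜 n (p + 1)) :
    contractCLM v φ = φ.curryLeft v := rfl

theorem contDiff_curryLeft {f : Space n → Alt 𝕜 n (p + 1)} (hf : ContDiff ℝ (⊤ : ℕ∞) f)
    (v : Space n) : ContDiff ℝ (⊤ : ℕ∞) (fun x => (f x).curryLeft v) := by
  exact (contractCLM v).contDiff.comp hf

theorem contDiff_divFun (η : Form 𝕜 b (p + 1)) : ContDiff ℝ (⊤ : ℕ∞) (divFun η) :=
  (ContDiff.sum fun _ _ => contDiff_curryLeft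
    ((contDiff_fderiv_pull η).clm_apply contDiff_const) _).neg

/-- The operator `- ∑ᵢ eᵢ ⌟ ∂ᵢ` on forms on the torus. -/
noncomputable def divLin : Form 𝕜 b (p + 1) →ₗ[𝕜] Form 𝕜 b p where
  toFun η := ofPeriodic (divFun η) (contDiff_divFun η)
    (fun x v hv => by rw [divFun, divFun, fderiv_pull_add_mem η x hv])
  map_add' η θ := by
    ext1 x
    change divFun (η + θ) x = divFun η x + divFun θ x
    have h : fderiv ℝ (pull (η + θ)) x = fderiv ℝ (pull η) x + fderiv ℝ (pull θ) x := by
      rw [pull_add]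
      exact fderiv_add ((contDiff_pull η).differentiable (by simp) x)
        ((contDiff_pull θ).differentiable (by simp) x)
    simp only [divFun, h, ← contractCLM_apply, add_apply, map_add,
      Finset.sum_add_distrib, neg_add]
  map_smul' c η := by
    ext1 x
    change divFun (c • η) x = c • divFun η x
    have : fderiv ℝ (pull (c • η)) x = c • fderiv ℝ (pull η) x := by
      exact congrFun (fderiv_const_smul_field (𝕜 := ℝ) c (f := pull η)) x
    simp only [divFun, this, smul_neg, Finset.smul_sum]
    rfl

theorem pull_divLin (η : Form 𝕜 b (p + 1)) : pull (divLin η) = divFun η := rfl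

theorem isFormalAdjoint_divLin : IsFormalAdjoint (divLin : Form 𝕜 b (p + 1) →ₗ[𝕜] Form 𝕜 b p) := by
  intro ω η
  have hg : ∀ i : Fin n, ContDiff ℝ (⊤ : ℕ∞)
      (fun x => altInner (pull ω x) ((pull η x).curryLeft (stdVec i))) := fun i =>
    contDiff_altInner (contDiff_pull ω) (contDiff_curryLeft (contDiff_pull η) _)
  have hpt : ∀ x : Space n, altInner (pull (extD ω) x) (pull η x) =
      altInner (pull ω x) (pull (divLin η) x) + ∑ i : Fin n,
        fderiv ℝ (fun x => altInner (pull ω x) ((pull η x).curryLeft (stdVec i))) x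
          (stdVec i) := by
    intro x
    rw [pull_extD, pull_divLin, extDeriv, altInner_alternatizeUncurryFin, divFun,
      altInner_neg_right, altInner_sum_right, neg_add_eq_sub, ← Finset.sum_sub_distrib]
    refine Finset.sum_congr rfl fun i _ => ?_
    rw [fderiv_altInner (contDiff_pull ω) (contDiff_curryLeft (contDiff_pull η) _)]
    have : fderiv ℝ (fun x => (pull η x).curryLeft (stdVec i)) x (stdVec i) =
        (fderiv ℝ (pull η) x (stdVec i)).curryLeft (stdVec i) := by
      have h := (contractCLM (stdVec i : Space n)).hasFDerivAt.comp x
        ((contDiff_pull η).differentiable (by simp) x).hasFDerivAt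
      have h' : HasFDerivAt (fun x => (pull η x).curryLeft (stdVec i)) _ x := h
      rw [h'.fderiv]
      rfl
    rw [this, add_sub_cancel_right]
  have hint : ∀ i : Fin n, IntegrableOn (fun x => fderiv ℝ
      (fun x => altInner (pull ω x) ((pull η x).curryLeft (stdVec i))) x (stdVec i))
      (ZSpan.fundamentalDomain b) := fun i =>
    integrableOn_fundamentalDomain _
      (((hg i).continuous_fderiv (by simp)).clm_apply continuous_const) b
  have hper : ∀ (i : Fin n) (x : Space n), ∀ v ∈ lattice b,
      altInner (pull ω (x + v)) ((pull η (x + v)).curryLeft (stdVec i)) =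
        altInner (pull ω x) ((pull η x).curryLeft (stdVec i)) := by
    intro i x v hv
    rw [pull_add_mem ω x hv, pull_add_mem η x hv]
  change ∫ x in ZSpan.fundamentalDomain b, altInner (pull (extD ω) x) (pull η x) =
    ∫ x in ZSpan.fundamentalDomain b, altInner (pull ω x) (pull (divLin η) x)
  simp only [hpt]
  rw [integral_add, integral_finsetSum _ fun i _ => hint i,
    Finset.sum_eq_zero fun i _ => integral_fderiv_eq_zero _ (hg i) b (hper i) _, add_zero]
  · exact integrableOn_fundamentalDomain _
      (contDiff_altInner (contDiff_pull ω) (contDiff_pull (divLin η))).continuous b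
  · exact integrable_finsetSum _ fun i _ => hint i

theorem altInner_self (φ : Alt 𝕜 n p) : altInner φ φ =
    (((p.factorial : ℝ)⁻¹ * ∑ I : Fin p → Fin n, ‖φ fun j => stdVec (I j)‖ ^ 2 : ℝ) : 𝕜) := by
  simp only [altInner, inner_self_eq_norm_sq_to_K]
  push_cast
  rfl

theorem eq_zero_of_altInner_self_re {φ : Alt 𝕜 n p}
    (h : RCLike.re (altInner φ φ) = 0) : φ = 0 := by
  rw [altInner_self, RCLike.ofReal_re] at h
  have hp : ((p.factorial : ℝ)⁻¹) ≠ 0 :=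
    inv_ne_zero (Nat.cast_ne_zero.2 (Nat.factorial_ne_zero p))
  have h1 := (mul_eq_zero.1 h).resolve_left hp
  rw [Finset.sum_eq_zero_iff_of_nonneg fun _ _ => by positivity] at h1
  apply ContinuousAlternatingMap.toAlternatingMap_injective
  refine (EuclideanSpace.basisFun (Fin n) ℝ).toBasis.ext_alternating fun I _ => ?_
  have h2 := h1 I (Finset.mem_univ I)
  simpa using h2

open scoped Pointwise in
theorem form_eq_zero_of_l2Inner_self {ω : Form 𝕜 b p} (h : l2Inner ω ω = 0) : ω = 0 := by
  have hcont : Continuous fun x => altInner (pull ω x) (pull ω x) :=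
    (contDiff_altInner (contDiff_pull ω) (contDiff_pull ω)).continuous
  have hre : Continuous fun x => RCLike.re (altInner (pull ω x) (pull ω x)) :=
    RCLike.continuous_re.comp hcont
  have hint := integrableOn_fundamentalDomain _ hcont b
  have h0 : ∫ x in ZSpan.fundamentalDomain b, RCLike.re (altInner (pull ω x) (pull ω x)) = 0 := by
    have h1 : RCLike.re (l2Inner ω ω) = 0 := by rw [h]; simp
    rw [← h1]
    exact integral_re hint
  have hnonneg : ∀ x, 0 ≤ RCLike.re (altInner (pull ω x) (pull ω x)) := by
    intro x
    rw [altInner_self, RCLike.ofReal_re]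
    positivity
  rw [setIntegral_eq_zero_iff_of_nonneg_ae (Filter.Eventually.of_forall hnonneg)
    (integrableOn_fundamentalDomain _ hre b)] at h0
  have : Countable (lattice b).toAddSubgroup := inferInstanceAs (Countable (lattice b))
  have hD := ZSpan.isAddFundamentalDomain' b (volume : Measure (Space n))
  have hz : volume {x | pull ω x ≠ 0} = 0 := by
    refine hD.measure_zero_of_invariant _ (fun v => ?_) ?_
    · ext x
      have hv : -(v : Space n) ∈ lattice b := (lattice b).neg_mem v.2
      have hmem : -v +ᵥ x = x + -(v : Space n) := by
        rw [AddSubgroup.vadd_def, vadd_eq_add, add_comm]; rfl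
      rw [Set.mem_vadd_set_iff_neg_vadd_mem, Set.mem_ofPred_eq, Set.mem_ofPred_eq, hmem,
        pull_add_mem ω x hv]
    · have h1 : ∀ᵐ x ∂volume.restrict (ZSpan.fundamentalDomain b), pull ω x = 0 := by
        filter_upwards [h0] with x hx
        exact eq_zero_of_altInner_self_re hx
      have h2 := (ae_iff.1 h1)
      rwa [Measure.restrict_apply₀' hD.nullMeasurableSet] at h2
  have hae : pull ω =ᵐ[volume] fun _ => 0 := hz
  have := (Continuous.ae_eq_iff_eq volume (contDiff_pull ω).continuous continuous_const).1 hae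
  ext1 x
  exact congrFun this x

theorem l2Inner_sub_right (ω η θ : Form 𝕜 b p) :
    l2Inner ω (η - θ) = l2Inner ω η - l2Inner ω θ := by
  have hint : ∀ η : Form 𝕜 b p, IntegrableOn (fun x => altInner (pull ω x) (pull η x))
      (ZSpan.fundamentalDomain b) := fun η => integrableOn_fundamentalDomain _
    (contDiff_altInner (contDiff_pull ω) (contDiff_pull η)).continuous b
  refine Eq.trans ?_ (integral_sub (hint η) (hint θ))
  refine integral_congr_ae (Filter.Eventually.of_forall fun x => ?_)
  change altInner (pull ω x) (pull η x - pull θ x) =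
    altInner (pull ω x) (pull η x) - altInner (pull ω x) (pull θ x)
  simp only [altInner, ContinuousAlternatingMap.sub_apply, inner_sub_right,
    Finset.sum_sub_distrib, mul_sub]

/-- The formal adjoint of the exterior derivative exists and is unique. -/
theorem existsUnique_formalAdjoint :
    ∃! δ : Form 𝕜 b (p + 1) →ₗ[𝕜] Form 𝕜 b p, IsFormalAdjoint δ := by
  refine ⟨divLin, isFormalAdjoint_divLin, fun δ hδ => ?_⟩
  refine LinearMap.ext fun η => ?_
  rw [← sub_eq_zero]
  apply form_eq_zero_of_l2Inner_self
  rw [l2Inner_sub_right, ← hδ, ← isFormalAdjoint_divLin, sub_self]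

/-- The codifferential `δ`: the formal adjoint of the exterior derivative. -/
noncomputable def codiff : Form 𝕜 b (p + 1) →ₗ[𝕜] Form 𝕜 b p :=
  Classical.choose (existsUnique_formalAdjoint (𝕜 := 𝕜) (b := b) (p := p)).exists

theorem isFormalAdjoint_codiff :
    IsFormalAdjoint (codiff : Form 𝕜 b (p + 1) →ₗ[𝕜] Form 𝕜 b p) :=
  Classical.choose_spec (existsUnique_formalAdjoint (𝕜 := 𝕜) (b := b) (p := p)).exists

theorem codiff_eq_divLin : (codiff : Form 𝕜 b (p + 1) →ₗ[𝕜] Form 𝕜 b p) = divLin :=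
  existsUnique_formalAdjoint.unique isFormalAdjoint_codiff isFormalAdjoint_divLin

end Basic

/-- The generalized Hodge-Laplace operator `α d δ + β δ d` on `p`-forms (on functions `δ = 0`). -/
noncomputable def genHodge (𝕜 : Type) [RCLike 𝕜] {n : ℕ} (b : Module.Basis (Fin n) ℝ (Space n))
    (α β : ℝ) : (p : ℕ) → Module.End 𝕜 (Form 𝕜 b p)
  | 0 => (β : 𝕜) • (codiff ∘ₗ extD)
  | _ + 1 => (α : 𝕜) • (extD ∘ₗ codiff) + (β : 𝕜) • (codiff ∘ₗ extD)

/-- The eigenspace of `α d δ + β δ d` on smooth `𝕜`-valued `p`-forms to `z`. -/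
noncomputable abbrev Eig (𝕜 : Type) [RCLike 𝕜] {n : ℕ} (b : Module.Basis (Fin n) ℝ (Space n))
    (α β : ℝ) (p : ℕ) (z : 𝕜) : Submodule 𝕜 (Form 𝕜 b p) :=
  Module.End.eigenspace (R := 𝕜) (M := Form 𝕜 b p) (genHodge 𝕜 b α β p) z

/-- A weighted set: a function which assigns to each complex number its multiplicity. The weighted
union of two weighted sets is the sum of the two functions. -/
abbrev WeightedSet : Type := ℂ → ℕ

/-- The weighted set which consists of `x` with multiplicity `m`. -/
noncomputable def weightedSingle (x : ℂ) (m : ℕ) : WeightedSet := Pi.single x m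

/-- The weighted union of a family of weighted sets (every point being in the support of only
finitely many members of the family). -/
noncomputable def weightedUnion {ι : Type} (W : ι → WeightedSet) : WeightedSet :=
  fun z => ∑ᶠ i, W i z

/-- The spectrum of `α d δ + β δ d` on `p`-forms as a weighted set. -/
noncomputable def spec {n : ℕ} (b : Module.Basis (Fin n) ℝ (Space n)) (α β : ℝ) (p : ℕ) :
    WeightedSet :=
  fun z => Module.finrank ℂ (Eig ℂ b α β p z)

section Fourier

variable {n : ℕ} {b : Module.Basis (Fin n) ℝ (Space n)}

/-- The number `4 π² γ |l|²`. -/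
noncomputable def lam (γ : ℝ) (l : dualLattice b) : ℝ := 4 * Real.pi ^ 2 * γ * ‖l.1‖ ^ 2

/-- The character `[x] ↦ exp (2 π i l(x))` of the torus. -/
noncomputable def chi (l : dualLattice b) (t : Torus b) : ℂ :=
  Quotient.liftOn' t (fun x => Complex.exp (2 * Real.pi * Complex.I * (l.1 x : ℂ))) (by
    intro x y hxy
    have h := (Submodule.quotientRel_def _).1 hxy
    obtain ⟨m, hm⟩ := l.2 _ h
    rw [map_sub, sub_eq_iff_eq_add] at hm
    have h1 : (2 * Real.pi * Complex.I * (l.1 x : ℂ)) =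
        2 * Real.pi * Complex.I * (l.1 y : ℂ) + m * (2 * Real.pi * Complex.I) := by
      rw [hm]
      push_cast
      ring
    simp only [h1]
    exact Complex.exp_periodic.int_mul m _)

theorem chi_proj (l : dualLattice b) (x : Space n) :
    chi l (proj b x) = Complex.exp (2 * Real.pi * Complex.I * (l.1 x : ℂ)) := rfl

theorem contDiff_chi (l : dualLattice b) :
    ContDiff ℝ (⊤ : ℕ∞) (fun x : Space n => chi l (proj b x)) := by
  simp only [chi_proj]
  exact (contDiff_const.mul (Complex.ofRealCLM.contDiff.comp l.1.contDiff)).cexp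

/-- The map `φ ↦ χ_l φ` on parallel (i.e. constant-coefficient) complex `p`-forms `φ`. -/
noncomputable def chiMul (l : dualLattice b) (p : ℕ) : Alt ℂ n p →ₗ[ℂ] Form ℂ b p where
  toFun φ := ⟨fun t => chi l t • φ, (contDiff_chi l).smul contDiff_const⟩
  map_add' φ ψ := by
    ext1 x
    exact smul_add (chi l (proj b x)) φ ψ
  map_smul' c φ := by
    ext1 x
    exact smul_comm (chi l (proj b x)) c φ

/-- The map `η ↦ l ∧ η`. -/
noncomputable def wedge (l : Space n →L[ℝ] ℝ) (p : ℕ) : Alt ℂ n p →ₗ[ℂ] Alt ℂ n (p + 1) where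
  toFun η := ContinuousAlternatingMap.alternatizeUncurryFin (l.smulRight η)
  map_add' η θ := by
    ext v
    simp [ContinuousAlternatingMap.alternatizeUncurryFin_apply, Finset.sum_add_distrib]
  map_smul' c η := by
    rw [← ContinuousAlternatingMap.alternatizeUncurryFin_smul]
    congr 1
    ext v : 1
    exact smul_comm (l v) c η

/-- The contraction `φ ↦ v ⌟ φ = φ(v, ·, ..., ·)`. -/
noncomputable def contract (v : Space n) (p : ℕ) : Alt ℂ n (p + 1) →ₗ[ℂ] Alt ℂ n p where
  toFun φ := φ.curryLeft v
  map_add' _ _ := rfl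
  map_smul' _ _ := rfl

/-- The vector `l^♯` with `⟨l^♯, ·⟩ = l`. -/
noncomputable def sharp (l : Space n →L[ℝ] ℝ) : Space n := (InnerProductSpace.toDual ℝ (Space n)).symm l

/-- The space `χ_l {l ∧ η | η a parallel (p - 1)-form}` of `p`-forms. -/
noncomputable def V (l : dualLattice b) : (p : ℕ) → Submodule ℂ (Form ℂ b p)
  | 0 => ⊥
  | p + 1 => (LinearMap.range (wedge l.1 p)).map (chiMul l (p + 1))

/-- The space `χ_l {φ | φ a parallel p-form with l^♯ ⌟ φ = 0}` of `p`-forms. -/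
noncomputable def W (l : dualLattice b) : (p : ℕ) → Submodule ℂ (Form ℂ b p)
  | 0 => LinearMap.range (chiMul l 0)
  | p + 1 => (LinearMap.ker (contract (sharp l.1) p)).map (chiMul l (p + 1))

/-- The submodule `U` is the (internal, algebraic) direct sum of the family `A`. -/
def IsDirectSum {M ι : Type} [AddCommGroup M] [Module ℂ M] (U : Submodule ℂ M)
    (A : ι → Submodule ℂ M) : Prop :=
  iSupIndep A ∧ U = ⨆ i, A i

/-- The family which consists of all `V l` with `|l| = r` and all `W l` with `|l| = s`. -/
noncomputable def eigFamily (b : Module.Basis (Fin n) ℝ (Space n)) (p : ℕ) (r s : ℝ) :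
    {l : dualLattice b // ‖l.1‖ = r} ⊕ {l : dualLattice b // ‖l.1‖ = s} →
      Submodule ℂ (Form ℂ b p) :=
  Sum.elim (fun l => V l.1 p) (fun l => W l.1 p)

end Fourier

end FlatTorus

/-! Fourier analysis turns `α dδ + β δd` into linear algebra on parallel forms. On the Fourier
coefficient at `l`, `d` acts as `2πi l ∧ ·` and `δ` as `-2πi l^♯ ⌟ ·`, so the operator acts as
`symbol` (`coeff_genHodge`). Cartan's formula for `w = l^♯` reads `l^♯ ⌟ (l ∧ η) + l ∧ (l^♯ ⌟ η) =
|l|² η`. It splits the parallel forms into the image of `l ∧ ·` and the kernel of `l^♯ ⌟ ·`, on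
which the symbol is the scalar `λ^l_α` and `λ^l_β` respectively. For `l ≠ 0` it also makes the
complex of the maps `l ∧ ·` exact, and rank-nullity with Pascal's rule gives the binomial
dimensions. For `l = 0` the symbol vanishes and the two binomials add up to the full dimension.

Trigonometric polynomials are dense, so a form is determined by its coefficients
(`form_eq_zero_of_coeff`), and it is an eigenform exactly if each coefficient is an eigenvector of
the symbol. Only finitely many `l` satisfy `λ^l_α = z` or `λ^l_β = z`; hence eigenforms are finite
Fourier sums and the eigenspace is a finite product of symbol eigenspaces (`bijective_eigCoeff`).
Counting dimensions gives the spectrum, and splitting each coefficient gives the direct sums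
(`isDirectSum_Eig`).

For real `z`, the operator commutes with real and imaginary parts, so the complex eigenspace is two
copies of the real one (`eigRealEquiv`). -/

namespace FlatTorus

/-! ### Exterior algebra: wedge, contraction and the symbol -/

section Alternating

open ContinuousAlternatingMap (alternatizeUncurryFin alternatizeUncurryFin_apply
  alternatizeUncurryFin_alternatizeUncurryFinCLM_comp_of_symmetric)

variable {n p : ℕ}

theorem wedge_apply (l : Space n →L[ℝ] ℝ) (η : Alt ℂ n p) (v : Fin (p + 1) → Space n) :
    wedge l p η v = ∑ i : Fin (p + 1), (-1) ^ (i : ℕ) • (l (v i) • η (i.removeNth v)) :=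
  alternatizeUncurryFin_apply _ _

theorem contract_apply (w : Space n) (φ : Alt ℂ n (p + 1)) (v : Fin p → Space n) :
    contract w p φ v = φ (Matrix.vecCons w v) := rfl

/-- Cartan's formula `w ⌟ (l ∧ η) + l ∧ (w ⌟ η) = l(w) η`. -/
theorem contract_wedge (l : Space n →L[ℝ] ℝ) (w : Space n) (η : Alt ℂ n (p + 1)) :
    contract w (p + 1) (wedge l (p + 1) η) + wedge l p (contract w p η) = l w • η := by
  ext v
  -- The term in which `l` takes `w` from the first slot is `l(w) η`. Every other term has its index
  -- shifted by one, hence the opposite sign, and cancels the matching term of `l ∧ (w ⌟ η)`.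
  rw [ContinuousAlternatingMap.add_apply, contract_apply, wedge_apply, Fin.sum_univ_succ, wedge_apply, add_assoc,
    ← Finset.sum_add_distrib, Finset.sum_eq_zero]
  · simp [Matrix.vecCons]
  · intro i _
    have : (i.succ.removeNth (Matrix.vecCons w v) : Fin (p + 1) → Space n) =
        Matrix.vecCons w (i.removeNth v) := by
      funext j
      refine Fin.cases ?_ (fun j => ?_) j <;> simp [Fin.removeNth]
    rw [this, contract_apply]
    simp [pow_succ]

theorem contract_wedge_zero (l : Space n →L[ℝ] ℝ) (w : Space n) (η : Alt ℂ n 0) :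
    contract w 0 (wedge l 0 η) = l w • η := by
  ext v
  rw [contract_apply, wedge_apply]
  simp [Subsingleton.elim _ v]

/-- The double wedge is the alternatization of `(x, y) ↦ l(x) l(y) η`, which is symmetric in `x` and
`y`. -/
theorem wedge_wedge (l : Space n →L[ℝ] ℝ) (η : Alt ℂ n p) : wedge l (p + 1) (wedge l p η) = 0 := by
  have h := alternatizeUncurryFin_alternatizeUncurryFinCLM_comp_of_symmetric
    (f := l.smulRight (l.smulRight η)) (fun x y => by simp [smul_smul, mul_comm])
  rw [← h]
  change alternatizeUncurryFin _ = _
  congr 1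
  ext x : 1
  simp [wedge]

theorem contract_contract (w : Space n) (φ : Alt ℂ n (p + 2)) :
    contract w p (contract w (p + 1) φ) = 0 := by
  ext v
  rw [contract_apply, contract_apply]
  exact φ.map_eq_zero_of_eq _ (i := 0) (j := 1) (by simp) (by simp)

theorem wedge_zero : wedge (0 : Space n →L[ℝ] ℝ) p = 0 := by
  ext η v
  rw [wedge_apply]
  simp

theorem contract_zero : contract (0 : Space n) p = 0 := by
  ext φ v
  rw [contract_apply]
  exact φ.map_coord_zero 0 (by simp)

theorem apply_sharp (l : Space n →L[ℝ] ℝ) : l (sharp l) = ‖l‖ ^ 2 := by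
  rw [sharp, ← (InnerProductSpace.toDual ℝ (Space n)).symm.norm_map l,
    ← real_inner_self_eq_norm_sq, InnerProductSpace.toDual_symm_apply]

/-- Expanding every argument in the standard basis writes the map as a polynomial in the
coordinates. -/
theorem continuous_alternatingMap (f : Space n [⋀^Fin p]→ₗ[ℝ] ℂ) : Continuous f := by
  have h : ∀ v, f v = ∑ I : Fin p → Fin n, (∏ j, v j (I j)) • f fun j => stdVec (I j) := by
    intro v
    have hv : v = fun j => ∑ i, v j i • (stdVec i : Space n) := by
      funext j
      simpa using ((EuclideanSpace.basisFun (Fin n) ℝ).sum_repr (v j)).symm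
    conv_lhs => rw [hv]
    have h1 := f.toMultilinearMap.map_sum (fun j i => v j i • (stdVec i : Space n))
    refine h1.trans (Finset.sum_congr rfl fun I _ => ?_)
    exact f.toMultilinearMap.map_smul_univ _ _
  have h2 : (f : (Fin p → Space n) → ℂ) = fun v =>
    ∑ I : Fin p → Fin n, (∏ j, v j (I j)) • f fun j => stdVec (I j) := funext h
  rw [h2]
  fun_prop

/-- In finite dimension all alternating maps are continuous. -/
noncomputable def altEquiv (n p : ℕ) : Alt ℂ n p ≃ₗ[ℝ] Space n [⋀^Fin p]→ₗ[ℝ] ℂ where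
  toFun φ := φ.toAlternatingMap
  map_add' _ _ := rfl
  map_smul' _ _ := rfl
  invFun f := { f with cont := continuous_alternatingMap f }
  left_inv _ := rfl
  right_inv _ := rfl

noncomputable def altEquivHom (n p : ℕ) : Alt ℂ n p ≃ₗ[ℝ] (⋀[ℝ]^p (Space n) →ₗ[ℝ] ℂ) :=
  altEquiv n p ≪≫ₗ exteriorPower.alternatingMapLinearEquiv

instance : FiniteDimensional ℝ (Alt ℂ n p) := (altEquivHom n p).symm.finiteDimensional

instance : FiniteDimensional ℂ (Alt ℂ n p) := FiniteDimensional.right ℝ ℂ _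

theorem finrank_alt : Module.finrank ℂ (Alt ℂ n p) = n.choose p := by
  -- Real dimensions are compared: twice the complex dimension on one side, `n.choose p` times the
  -- real dimension 2 of `ℂ` on the other.
  have h := (altEquivHom n p).finrank_eq
  rw [Module.finrank_linearMap, exteriorPower.finrank_eq, finrank_euclideanSpace_fin,
    Complex.finrank_real_complex, finrank_real_of_complex] at h
  omega

variable {l : Space n →L[ℝ] ℝ}

/-- Cartan's formula with `l(l^♯) = |l|²`, the scalar now complex. For `l ≠ 0` this makes `|l|⁻² l^♯
⌟ ·` a contracting homotopy for `l ∧ ·`. -/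
theorem contract_wedge_sharp (l : Space n →L[ℝ] ℝ) (η : Alt ℂ n (p + 1)) :
    contract (sharp l) (p + 1) (wedge l (p + 1) η) + wedge l p (contract (sharp l) p η) =
      (‖l‖ ^ 2 : ℂ) • η := by
  rw [contract_wedge, apply_sharp, ← Complex.ofReal_pow]
  exact (Complex.coe_smul (‖l‖ ^ 2) η).symm

theorem ofReal_norm_sq_ne_zero (hl : l ≠ 0) : (‖l‖ ^ 2 : ℂ) ≠ 0 :=
  pow_ne_zero _ (Complex.ofReal_ne_zero.2 (norm_ne_zero_iff.2 hl))

/-- Exactness from the homotopy: if `l ∧ η = 0`, then `η` is the wedge of `l` with `|l|⁻² l^♯ ⌟ η`.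
-/
theorem range_wedge_eq_ker (hl : l ≠ 0) :
    LinearMap.range (wedge l p) = LinearMap.ker (wedge l (p + 1)) := by
  apply le_antisymm
  · rintro _ ⟨η, rfl⟩
    exact wedge_wedge l η
  · intro η hη
    have h := contract_wedge_sharp l η
    rw [LinearMap.mem_ker.1 hη, map_zero, zero_add] at h
    refine ⟨(‖l‖ ^ 2 : ℂ)⁻¹ • contract (sharp l) p η, ?_⟩
    rw [map_smul, h, inv_smul_smul₀ (ofReal_norm_sq_ne_zero hl) η]

theorem ker_wedge_zero (hl : l ≠ 0) : LinearMap.ker (wedge l 0) = ⊥ := by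
  refine (Submodule.eq_bot_iff _).2 fun η hη => ?_
  have h := contract_wedge_zero l (sharp l) η
  rw [LinearMap.mem_ker.1 hη, map_zero, apply_sharp] at h
  exact (smul_eq_zero.1 h.symm).resolve_left (pow_ne_zero _ (norm_ne_zero_iff.2 hl))

/-- By exactness the rank in one degree is the nullity in the next, so rank-nullity gives the
recursion of Pascal's rule. -/
theorem finrank_range_wedge (hn : 1 ≤ n) (hl : l ≠ 0) :
    Module.finrank ℂ (LinearMap.range (wedge l p)) = (n - 1).choose p := by
  obtain ⟨m, rfl⟩ := Nat.exists_eq_add_of_le' hn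
  induction p with
  | zero =>
    have h := LinearMap.finrank_range_add_finrank_ker (wedge l 0)
    rw [ker_wedge_zero hl, finrank_bot, finrank_alt] at h
    simpa using h
  | succ p ih =>
    have h := LinearMap.finrank_range_add_finrank_ker (wedge l (p + 1))
    rw [← range_wedge_eq_ker hl, ih, finrank_alt, Nat.choose_succ_succ'] at h
    simp only [Nat.add_sub_cancel] at h ⊢
    omega

theorem sharp_zero : sharp (0 : Space n →L[ℝ] ℝ) = 0 :=
  map_zero _

/-- For `l ≠ 0`, both summands of the homotopy formula vanish on the intersection, and they lie in
the two spaces in general, because contracting twice gives zero. For `l = 0` the spaces are zero and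
everything. -/
theorem isCompl_range_wedge_ker_contract (l : Space n →L[ℝ] ℝ) :
    IsCompl (LinearMap.range (wedge l p)) (LinearMap.ker (contract (sharp l) p)) := by
  rcases eq_or_ne l 0 with rfl | hl
  · rw [wedge_zero, sharp_zero, contract_zero, LinearMap.range_zero, LinearMap.ker_zero]
    exact isCompl_bot_top
  have hl2 := ofReal_norm_sq_ne_zero hl
  constructor
  · rw [Submodule.disjoint_def, range_wedge_eq_ker hl]
    intro η h1 h2
    have h := contract_wedge_sharp l η
    rw [LinearMap.mem_ker.1 h1, LinearMap.mem_ker.1 h2, map_zero, map_zero, add_zero] at h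
    exact (smul_eq_zero.1 h.symm).resolve_left hl2
  · rw [codisjoint_iff, Submodule.eq_top_iff']
    intro η
    rw [← inv_smul_smul₀ hl2 η, ← contract_wedge_sharp l η, add_comm (contract _ _ _)]
    exact Submodule.smul_mem _ _ (Submodule.add_mem_sup ⟨_, rfl⟩ (contract_contract _ _))

theorem finrank_ker_contract (hn : 1 ≤ n) (hl : l ≠ 0) :
    Module.finrank ℂ (LinearMap.ker (contract (sharp l) p)) = (n - 1).choose (p + 1) := by
  have h := Submodule.finrank_add_eq_of_isCompl (isCompl_range_wedge_ker_contract (p := p) l)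
  obtain ⟨m, rfl⟩ := Nat.exists_eq_add_of_le' hn
  rw [finrank_range_wedge hn hl, finrank_alt, Nat.choose_succ_succ'] at h
  simp only [Nat.add_sub_cancel] at h ⊢
  omega

/-- The symbol `4 π² (α l ∧ (l^♯ ⌟ ·) + β l^♯ ⌟ (l ∧ ·))` of `α d δ + β δ d`. -/
noncomputable def symbol (α β : ℝ) (l : Space n →L[ℝ] ℝ) (p : ℕ) :
    Module.End ℂ (Alt ℂ n (p + 1)) :=
  (4 * Real.pi ^ 2 : ℂ) • ((α : ℂ) • (wedge l p ∘ₗ contract (sharp l) p) +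
    (β : ℂ) • (contract (sharp l) (p + 1) ∘ₗ wedge l (p + 1)))

variable {α β : ℝ}

theorem symbol_of_mem_range_wedge {η : Alt ℂ n (p + 1)} (h : η ∈ LinearMap.range (wedge l p)) :
    symbol α β l p η = ((4 * Real.pi ^ 2 * α * ‖l‖ ^ 2 : ℝ) : ℂ) • η := by
  obtain ⟨θ, rfl⟩ := h
  have h1 := contract_wedge_sharp l (wedge l p θ)
  rw [wedge_wedge, map_zero, zero_add] at h1
  change (4 * Real.pi ^ 2 : ℂ) • ((α : ℂ) • wedge l p (contract (sharp l) p (wedge l p θ)) +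
    (β : ℂ) • contract (sharp l) (p + 1) (wedge l (p + 1) (wedge l p θ))) = _
  rw [h1, wedge_wedge, map_zero, smul_zero (A := Alt ℂ n (p + 1)) (β : ℂ), add_zero, ← mul_smul, ← mul_smul]
  congr 1
  push_cast
  ring

theorem symbol_of_mem_ker_contract {η : Alt ℂ n (p + 1)}
    (h : η ∈ LinearMap.ker (contract (sharp l) p)) :
    symbol α β l p η = ((4 * Real.pi ^ 2 * β * ‖l‖ ^ 2 : ℝ) : ℂ) • η := by
  have h1 := contract_wedge_sharp l η
  rw [LinearMap.mem_ker.1 h, map_zero, add_zero] at h1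
  change (4 * Real.pi ^ 2 : ℂ) • ((α : ℂ) • wedge l p (contract (sharp l) p η) +
    (β : ℂ) • contract (sharp l) (p + 1) (wedge l (p + 1) η)) = _
  rw [h1, LinearMap.mem_ker.1 h, map_zero, smul_zero (A := Alt ℂ n (p + 1)) (α : ℂ), zero_add, ← mul_smul, ← mul_smul]
  congr 1
  push_cast
  ring

/-- The symbol acts on the two complementary summands by scalars, so the eigenvalue equation can be
tested on each component separately. -/
theorem mem_eigenspace_symbol_iff {z : ℂ} {η θ : Alt ℂ n (p + 1)}
    (hη : η ∈ LinearMap.range (wedge l p)) (hθ : θ ∈ LinearMap.ker (contract (sharp l) p)) :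
    η + θ ∈ Module.End.eigenspace (symbol α β l p) z ↔
      (((4 * Real.pi ^ 2 * α * ‖l‖ ^ 2 : ℝ) : ℂ) = z ∨ η = 0) ∧
      (((4 * Real.pi ^ 2 * β * ‖l‖ ^ 2 : ℝ) : ℂ) = z ∨ θ = 0) := by
  rw [Module.End.mem_eigenspace_iff, map_add, symbol_of_mem_range_wedge hη,
    symbol_of_mem_ker_contract hθ, ← sub_eq_zero, smul_add z η θ, add_sub_add_comm,
    ← sub_smul _ z η, ← sub_smul _ z θ]
  set x : ℂ := ((4 * Real.pi ^ 2 * α * ‖l‖ ^ 2 : ℝ) : ℂ)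
  set y : ℂ := ((4 * Real.pi ^ 2 * β * ‖l‖ ^ 2 : ℝ) : ℂ)
  have hd := Submodule.disjoint_def.1 (isCompl_range_wedge_ker_contract (p := p) l).disjoint
  constructor
  · intro h
    have h1 : (x - z) • η = -((y - z) • θ) := eq_neg_of_add_eq_zero_left h
    have h2 : (x - z) • η = 0 := by
      refine hd _ (Submodule.smul_mem _ _ hη) ?_
      rw [h1]
      exact Submodule.neg_mem _ (Submodule.smul_mem _ _ hθ)
    rw [h2, zero_add] at h
    exact ⟨(smul_eq_zero.1 h2).imp_left sub_eq_zero.1, (smul_eq_zero.1 h).imp_left sub_eq_zero.1⟩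
  · rintro ⟨h1, h2⟩
    rw [smul_eq_zero.2 (h1.imp_left sub_eq_zero.2), smul_eq_zero.2 (h2.imp_left sub_eq_zero.2),
      add_zero]

theorem symbol_zero : symbol α β (0 : Space n →L[ℝ] ℝ) p = 0 := by
  simp [symbol, wedge_zero]

theorem finrank_sup_of_disjoint {K M : Type*} [Field K] [AddCommGroup M] [Module K M]
    [FiniteDimensional K M] {A B : Submodule K M} (h : Disjoint A B) :
    Module.finrank K ↥(A ⊔ B) = Module.finrank K A + Module.finrank K B := by
  have := Submodule.finrank_sup_add_finrank_inf_eq A B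
  rwa [h.eq_bot, finrank_bot, add_zero] at this

theorem finrank_ite_bot {K M : Type*} [Field K] [AddCommGroup M] [Module K M] (P : Prop)
    [Decidable P] (A : Submodule K M) :
    Module.finrank K ↥(if P then A else ⊥) = if P then Module.finrank K A else 0 := by
  by_cases h : P
  · rw [if_pos h, if_pos h]
  · rw [if_neg h, if_neg h, finrank_bot]

open scoped Classical in
/-- The eigenspace of the symbol is spanned by its parts in `l ∧ Λᵖ` and in `ker (l^♯ ⌟ ·)`. -/
theorem eigenspace_symbol (α β : ℝ) (l : Space n →L[ℝ] ℝ) (p : ℕ) (z : ℂ) :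
    Module.End.eigenspace (symbol α β l p) z =
      (if ((4 * Real.pi ^ 2 * α * ‖l‖ ^ 2 : ℝ) : ℂ) = z then LinearMap.range (wedge l p) else ⊥) ⊔
      (if ((4 * Real.pi ^ 2 * β * ‖l‖ ^ 2 : ℝ) : ℂ) = z then
        LinearMap.ker (contract (sharp l) p) else ⊥) := by
  apply le_antisymm
  · intro ω hω
    obtain ⟨η, hη, θ, hθ, rfl⟩ := Submodule.mem_sup.1
      ((isCompl_range_wedge_ker_contract (p := p) l).sup_eq_top ▸ Submodule.mem_top (x := ω))
    obtain ⟨h1, h2⟩ := (mem_eigenspace_symbol_iff hη hθ).1 hω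
    refine Submodule.add_mem_sup ?_ ?_
    · split_ifs with h
      · exact hη
      · exact h1.resolve_left h
    · split_ifs with h
      · exact hθ
      · exact h2.resolve_left h
  · refine sup_le ?_ ?_
    · split_ifs with h
      · intro η hη
        rw [Module.End.mem_eigenspace_iff, symbol_of_mem_range_wedge hη, h]
      · exact bot_le
    · split_ifs with h
      · intro η hη
        rw [Module.End.mem_eigenspace_iff, symbol_of_mem_ker_contract hη, h]
      · exact bot_le

open scoped Classical in
-- The case `l = 0` is separate: the individual summands then do not have the binomial dimensions,
-- but both eigenvalues are zero and the two binomials add up to the dimension of the whole space by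
-- Pascal's rule.
theorem finrank_eigenspace_symbol (hn : 1 ≤ n) (l : Space n →L[ℝ] ℝ) (z : ℂ) :
    Module.finrank ℂ (Module.End.eigenspace (symbol α β l p) z) =
      (if ((4 * Real.pi ^ 2 * α * ‖l‖ ^ 2 : ℝ) : ℂ) = z then (n - 1).choose p else 0) +
      (if ((4 * Real.pi ^ 2 * β * ‖l‖ ^ 2 : ℝ) : ℂ) = z then (n - 1).choose (p + 1) else 0) := by
  by_cases hl : l = 0
  · subst hl
    rw [symbol_zero]
    by_cases hz : z = 0
    · subst hz
      obtain ⟨m, rfl⟩ := Nat.exists_eq_add_of_le' hn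
      rw [Module.End.eigenspace_zero, LinearMap.ker_zero, finrank_top, finrank_alt,
        Nat.choose_succ_succ']
      simp
    · have : Module.End.eigenspace (0 : Module.End ℂ (Alt ℂ n (p + 1))) z = ⊥ := by
        refine (Submodule.eq_bot_iff _).2 fun η hη => ?_
        have h := (Module.End.mem_eigenspace_iff.1 hη).symm
        exact (smul_eq_zero.1 h).resolve_left hz
      rw [this, finrank_bot]
      simp [Ne.symm hz]
  · rw [eigenspace_symbol, finrank_sup_of_disjoint]
    · rw [finrank_ite_bot, finrank_ite_bot, finrank_range_wedge hn hl, finrank_ker_contract hn hl]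
    · refine (isCompl_range_wedge_ker_contract l).disjoint.mono ?_ ?_ <;> split_ifs <;> simp

end Alternating

end FlatTorus

namespace FlatTorus

/-! ### Fourier coefficients and the action of the operators on them -/

section FourierCoefficients

variable {n p : ℕ} {b : Module.Basis (Fin n) ℝ (Space n)}

theorem chi_add (l m : dualLattice b) (t : Torus b) : chi (l + m) t = chi l t * chi m t := by
  obtain ⟨x, rfl⟩ := Submodule.Quotient.mk_surjective _ t
  change chi (l + m) (proj b x) = chi l (proj b x) * chi m (proj b x)
  rw [chi_proj, chi_proj, chi_proj, ← Complex.exp_add]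
  congr 1
  simp
  ring

theorem chi_zero (t : Torus b) : chi (0 : dualLattice b) t = 1 := by
  obtain ⟨x, rfl⟩ := Submodule.Quotient.mk_surjective _ t
  change chi 0 (proj b x) = 1
  simp [chi_proj]

theorem proj_add_mem (x : Space n) {v : Space n} (hv : v ∈ lattice b) :
    proj b (x + v) = proj b x := by
  rw [proj, proj, Submodule.Quotient.eq]
  simpa using hv

theorem fderiv_chi (l : dualLattice b) (x w : Space n) :
    fderiv ℝ (fun x => chi l (proj b x)) x w =
      2 * Real.pi * Complex.I * (l.1 w : ℂ) * chi l (proj b x) := by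
  simp only [chi_proj]
  have h := (((Complex.ofRealCLM.hasFDerivAt (x := l.1 x)).comp x l.1.hasFDerivAt).const_mul
    (2 * Real.pi * Complex.I)).cexp
  have h' : HasFDerivAt (fun x => Complex.exp (2 * Real.pi * Complex.I * (l.1 x : ℂ))) _ x := h
  rw [h'.fderiv]
  simp
  ring

/-- In a direction `w` with `l(w) ≠ 0`, the character is a nonzero multiple of its own derivative,
and derivatives of periodic functions integrate to zero. -/
theorem integral_chi_of_ne_zero {l : dualLattice b} (hl : l ≠ 0) :
    ∫ x in ZSpan.fundamentalDomain b, chi l (proj b x) = 0 := by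
  obtain ⟨w, hw⟩ : ∃ w, l.1 w ≠ 0 := by
    by_contra! h
    exact hl (Subtype.ext (ContinuousLinearMap.ext h))
  have h := integral_fderiv_eq_zero _ (contDiff_chi l) b
    (fun x v hv => by rw [proj_add_mem x hv]) w
  simp only [fderiv_chi] at h
  rw [integral_const_mul] at h
  refine (mul_eq_zero.1 h).resolve_left ?_
  simp [hw, Real.pi_ne_zero]

theorem measureReal_fundamentalDomain_ne_zero (b : Module.Basis (Fin n) ℝ (Space n)) :
    volume.real (ZSpan.fundamentalDomain b) ≠ 0 :=
  ENNReal.toReal_ne_zero.2 ⟨ZSpan.measure_fundamentalDomain_ne_zero b,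
    (ZSpan.fundamentalDomain_isBounded b).measure_lt_top.ne⟩

/-- The Fourier coefficients of periodic functions. -/
noncomputable def scalarCoeff (l : dualLattice b) (g : Space n → ℂ) : ℂ :=
  (volume.real (ZSpan.fundamentalDomain b) : ℂ)⁻¹ *
    ∫ x in ZSpan.fundamentalDomain b, chi (-l) (proj b x) * g x

theorem integrableOn_chi_mul (l : dualLattice b) {g : Space n → ℂ} (hg : Continuous g) :
    IntegrableOn (fun x => chi l (proj b x) * g x) (ZSpan.fundamentalDomain b) :=
  integrableOn_fundamentalDomain _ ((contDiff_chi l).continuous.mul hg) b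

theorem scalarCoeff_sum (l : dualLattice b) {ι : Type*} (s : Finset ι) (c : ι → ℂ)
    {g : ι → Space n → ℂ} (hg : ∀ i, Continuous (g i)) :
    scalarCoeff l (fun x => ∑ i ∈ s, c i * g i x) = ∑ i ∈ s, c i * scalarCoeff l (g i) := by
  simp only [scalarCoeff, Finset.mul_sum, mul_left_comm _ (c _)]
  rw [integral_finsetSum _ fun i _ => (integrableOn_chi_mul _ (hg i)).const_mul _, Finset.mul_sum]
  refine Finset.sum_congr rfl fun i _ => ?_
  rw [integral_const_mul, mul_left_comm]

/-- Integration by parts: the derivative of the periodic function `χ_{-l} g` has integral zero. -/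
theorem scalarCoeff_fderiv (l : dualLattice b) {g : Space n → ℂ} (hg : ContDiff ℝ (⊤ : ℕ∞) g)
    (hper : ∀ x, ∀ v ∈ lattice b, g (x + v) = g x) (w : Space n) :
    scalarCoeff l (fun x => fderiv ℝ g x w) =
      2 * Real.pi * Complex.I * (l.1 w : ℂ) * scalarCoeff l g := by
  have h := integral_fderiv_eq_zero _ ((contDiff_chi (-l)).mul hg) b
    (fun x v hv => by rw [hper x v hv, proj_add_mem x hv]) w
  have h1 : ∀ x, fderiv ℝ (fun x => chi (-l) (proj b x) * g x) x w =
      chi (-l) (proj b x) * fderiv ℝ g x w -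
        2 * Real.pi * Complex.I * (l.1 w : ℂ) * (chi (-l) (proj b x) * g x) := by
    intro x
    rw [fderiv_fun_mul ((contDiff_chi (-l)).differentiable (by simp) x)
      (hg.differentiable (by simp) x), add_apply, smul_apply, smul_apply,
      fderiv_chi]
    simp
    ring
  have hc : Continuous (fun x => fderiv ℝ g x w) :=
    (hg.continuous_fderiv (by simp)).clm_apply continuous_const
  simp only [h1] at h
  rw [integral_sub (integrableOn_chi_mul _ hc)
    ((integrableOn_chi_mul _ hg.continuous).const_mul _), integral_const_mul, sub_eq_zero] at h
  rw [scalarCoeff, scalarCoeff, h]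
  ring

/-- The Fourier coefficients of forms, which are parallel forms. -/
noncomputable def coeff (l : dualLattice b) : Form ℂ b p →ₗ[ℂ] Alt ℂ n p where
  toFun ω := (volume.real (ZSpan.fundamentalDomain b) : ℂ)⁻¹ •
    ∫ x in ZSpan.fundamentalDomain b, chi (-l) (proj b x) • pull ω x
  map_add' ω η := by
    have h : ∀ ω : Form ℂ b p, IntegrableOn (fun x => chi (-l) (proj b x) • pull ω x)
        (ZSpan.fundamentalDomain b) := fun ω => integrableOn_fundamentalDomain _
      ((contDiff_chi (-l)).continuous.smul (contDiff_pull ω).continuous) b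
    rw [← smul_add _ (_ : Alt ℂ n p) _, ← integral_add (h ω) (h η)]
    congr 2
    funext x
    exact smul_add _ _ _
  map_smul' c ω := by
    rw [RingHom.id_apply, smul_comm c _ (_ : Alt ℂ n p), ← integral_smul c]
    congr 1
    refine integral_congr_ae (Filter.Eventually.of_forall fun x => ?_)
    exact smul_comm (chi (-l) (proj b x)) c (pull ω x)

theorem coeff_apply (l : dualLattice b) (ω : Form ℂ b p) (v : Fin p → Space n) :
    coeff l ω v = scalarCoeff l (fun x => pull ω x v) := by
  have h : IntegrableOn (fun x => chi (-l) (proj b x) • pull ω x)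
      (ZSpan.fundamentalDomain b) := integrableOn_fundamentalDomain _
    ((contDiff_chi (-l)).continuous.smul (contDiff_pull ω).continuous) b
  have h1 := (ContinuousAlternatingMap.apply ℝ (Space n) ℂ v).integral_comp_comm h
  change (volume.real (ZSpan.fundamentalDomain b) : ℂ)⁻¹ • (ContinuousAlternatingMap.apply ℝ (Space n) ℂ v _) = _
  rw [← h1]
  rfl

theorem continuous_pull_apply (ω : Form ℂ b p) (v : Fin p → Space n) :
    Continuous (fun x => pull ω x v) :=
  (pull_apply_contDiff ω v).continuous

theorem fderiv_pull_apply (ω : Form ℂ b p) (v : Fin p → Space n) (x w : Space n) :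
    fderiv ℝ (fun x => pull ω x v) x w = fderiv ℝ (pull ω) x w v := by
  have h := (ContinuousAlternatingMap.apply ℝ (Space n) ℂ v).hasFDerivAt.comp x
    ((contDiff_pull ω).differentiable (by simp) x).hasFDerivAt
  have h' : HasFDerivAt (fun x => pull ω x v) _ x := h
  rw [h'.fderiv]
  rfl

theorem continuous_fderiv_pull_apply (ω : Form ℂ b p) (v : Fin p → Space n) (w : Space n) :
    Continuous (fun x => fderiv ℝ (pull ω) x w v) := by
  simp only [← fderiv_pull_apply]
  exact ((pull_apply_contDiff ω v).continuous_fderiv (by simp)).clm_apply continuous_const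

theorem scalarCoeff_fderiv_pull (l : dualLattice b) (ω : Form ℂ b p) (v : Fin p → Space n)
    (w : Space n) : scalarCoeff l (fun x => fderiv ℝ (pull ω) x w v) =
      2 * Real.pi * Complex.I * (l.1 w : ℂ) * coeff l ω v := by
  rw [coeff_apply, ← scalarCoeff_fderiv l (pull_apply_contDiff ω v)
    (fun x v hv => by rw [pull_add_mem ω x hv])]
  simp only [fderiv_pull_apply]

theorem coeff_extD (l : dualLattice b) (ω : Form ℂ b p) :
    coeff l (extD ω) = (2 * Real.pi * Complex.I : ℂ) • wedge l.1 p (coeff l ω) := by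
  ext v
  rw [coeff_apply, ContinuousAlternatingMap.smul_apply, wedge_apply]
  have h : ∀ x, pull (extD ω) x v = ∑ i : Fin (p + 1),
      (-1 : ℂ) ^ (i : ℕ) * fderiv ℝ (pull ω) x (v i) (i.removeNth v) := by
    intro x
    rw [pull_extD, extDeriv, ContinuousAlternatingMap.alternatizeUncurryFin_apply]
    refine Finset.sum_congr rfl fun i _ => ?_
    rcases neg_one_pow_eq_or ℤ (i : ℕ) with h | h <;>
      rcases neg_one_pow_eq_or ℂ (i : ℕ) with h' | h' <;> simp [zsmul_eq_mul]
  rw [show (fun x => _) = _ from funext h, scalarCoeff_sum _ _ _ fun i => continuous_fderiv_pull_apply ω _ _,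
    Finset.smul_sum]
  refine Finset.sum_congr rfl fun i _ => ?_
  rw [scalarCoeff_fderiv_pull]
  simp [zsmul_eq_mul]
  ring

theorem sharp_eq_sum (l : Space n →L[ℝ] ℝ) : sharp l = ∑ i, l (stdVec i) • stdVec i := by
  have h := (EuclideanSpace.basisFun (Fin n) ℝ).sum_repr' (sharp l)
  rw [← h]
  refine Finset.sum_congr rfl fun i _ => ?_
  rw [real_inner_comm, sharp, InnerProductSpace.toDual_symm_apply, EuclideanSpace.basisFun_apply]

/-- The explicit formula `δ = -∑ eᵢ ⌟ ∂ᵢ` applies; each `∂ᵢ` contributes `2πi l(eᵢ)`, and `∑ l(eᵢ)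
eᵢ = l^♯`. -/
theorem coeff_codiff (l : dualLattice b) (ω : Form ℂ b (p + 1)) :
    coeff l (codiff ω) = -(2 * Real.pi * Complex.I : ℂ) • contract (sharp l.1) p (coeff l ω) := by
  ext v
  rw [coeff_apply, codiff_eq_divLin, ContinuousAlternatingMap.smul_apply]
  have h : ∀ x, pull (divLin ω) x v = ∑ i : Fin n,
      (-1 : ℂ) * fderiv ℝ (pull ω) x (stdVec i) (Matrix.vecCons (stdVec i) v) := by
    intro x
    rw [pull_divLin, divFun]
    simp [ContinuousAlternatingMap.sum_apply]
  have h2 : contract (sharp l.1) p (coeff l ω) v =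
      ∑ i : Fin n, (l.1 (stdVec i) : ℂ) * coeff l ω (Matrix.vecCons (stdVec i) v) := by
    have h3 : contract (sharp l.1) p (coeff l ω) = (coeff l ω).curryLeft (sharp l.1) := rfl
    rw [h3, sharp_eq_sum, map_sum, ContinuousAlternatingMap.sum_apply]
    refine Finset.sum_congr rfl fun i _ => ?_
    rw [map_smul, ContinuousAlternatingMap.smul_apply, Complex.real_smul]
    rfl
  rw [show (fun x => _) = _ from funext h, scalarCoeff_sum _ _ _ fun i => continuous_fderiv_pull_apply ω _ _,
    h2, Finset.smul_sum]
  refine Finset.sum_congr rfl fun i _ => ?_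
  rw [scalarCoeff_fderiv_pull]
  simp
  ring

theorem coeff_genHodge (α β : ℝ) (l : dualLattice b) (ω : Form ℂ b (p + 1)) :
    coeff l (genHodge ℂ b α β (p + 1) ω) = symbol α β l.1 p (coeff l ω) := by
  change coeff l ((α : ℂ) • extD (codiff ω) + (β : ℂ) • codiff (extD ω)) =
    (4 * Real.pi ^ 2 : ℂ) • ((α : ℂ) • wedge l.1 p (contract (sharp l.1) p (coeff l ω)) +
    (β : ℂ) • contract (sharp l.1) (p + 1) (wedge l.1 (p + 1) (coeff l ω)))
  -- The product of the factors of `d` and `δ`, which is the constant in the symbol.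
  have hI : 2 * Real.pi * Complex.I * -(2 * Real.pi * Complex.I) = (4 * Real.pi ^ 2 : ℂ) := by
    linear_combination (-4 * Real.pi ^ 2 : ℂ) * Complex.I_sq
  rw [map_add, map_smul, map_smul, coeff_extD, coeff_codiff, coeff_codiff, coeff_extD, map_smul,
    map_smul, ← mul_smul _ _ (wedge _ _ _), ← mul_smul _ _ (contract _ _ _), mul_comm (-_), hI,
    smul_add _ (_ : Alt ℂ n (p + 1)) _, smul_comm (α : ℂ) _ (_ : Alt ℂ n (p + 1)),
    smul_comm (β : ℂ) _ (_ : Alt ℂ n (p + 1))]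

open scoped Classical in
-- Orthogonality of characters: `χ_{-m} χ_l = χ_{l-m}` has mean one or zero.
theorem coeff_chiMul (l m : dualLattice b) (φ : Alt ℂ n p) :
    coeff m (chiMul l p φ) = if m = l then φ else 0 := by
  ext v
  rw [coeff_apply, scalarCoeff]
  have h : ∀ x, chi (-m) (proj b x) * pull (chiMul l p φ) x v =
      chi (-m + l) (proj b x) * φ v := by
    intro x
    rw [chi_add, mul_assoc]
    rfl
  simp only [h]
  rw [integral_mul_const]
  split_ifs with hml
  · subst hml
    have hV : (volume.real (ZSpan.fundamentalDomain b) : ℂ) ≠ 0 :=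
      Complex.ofReal_ne_zero.2 (measureReal_fundamentalDomain_ne_zero b)
    simp only [neg_add_cancel, chi_zero]
    rw [setIntegral_const, Complex.real_smul, mul_one, inv_mul_cancel_left₀ hV]
  · rw [integral_chi_of_ne_zero (fun h => hml (neg_add_eq_zero.1 h))]
    simp

end FourierCoefficients

end FlatTorus

namespace FlatTorus

/-! ### Completeness of the characters and discreteness of the dual lattice -/

section Completeness

variable {n p : ℕ} {b : Module.Basis (Fin n) ℝ (Space n)}

/-- The homeomorphism from `ℝⁿ / Λ` to the standard torus, composed with the projection. -/
noncomputable def toUnitTorus (b : Module.Basis (Fin n) ℝ (Space n)) (x : Space n) :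
    UnitAddTorus (Fin n) :=
  fun i => ((b.equivFunL x i : ℝ) : UnitAddCircle)

theorem isQuotientMap_toUnitTorus (b : Module.Basis (Fin n) ℝ (Space n)) :
    Topology.IsQuotientMap (toUnitTorus b) := by
  have h1 : IsOpenQuotientMap (fun (t : Fin n → ℝ) (i : Fin n) => ((t i : ℝ) : UnitAddCircle)) :=
    IsOpenQuotientMap.piMap fun _ => QuotientAddGroup.isOpenQuotientMap_mk
  exact (h1.comp b.equivFunL.toHomeomorph.isOpenQuotientMap).isQuotientMap

theorem sub_mem_lattice_of_toUnitTorus_eq {x y : Space n} (h : toUnitTorus b x = toUnitTorus b y) :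
    x - y ∈ lattice b := by
  rw [b.mem_span_iff_repr_mem ℤ]
  intro i
  have hi : ((b.equivFunL x i : ℝ) : UnitAddCircle) = (b.equivFunL y i : ℝ) := congrFun h i
  rw [← sub_eq_zero, ← AddCircle.coe_sub, AddCircle.coe_eq_zero_iff] at hi
  obtain ⟨m, hm⟩ := hi
  refine ⟨m, ?_⟩
  simpa using hm

/-- The linear form with integral coordinates `m` with respect to the dual basis of `b`. -/
noncomputable def dualOfInt (b : Module.Basis (Fin n) ℝ (Space n)) (m : Fin n → ℤ) :
    dualLattice b :=
  ⟨∑ i, (m i : ℝ) • (ContinuousLinearMap.proj i ∘L (b.equivFunL : Space n →L[ℝ] Fin n → ℝ)), by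
    intro v hv
    rw [b.mem_span_iff_repr_mem ℤ] at hv
    choose k hk using hv
    refine ⟨∑ i, m i * k i, ?_⟩
    simp only [sum_apply]
    push_cast
    refine Finset.sum_congr rfl fun i _ => ?_
    simp [← hk]⟩

/-- Every Fourier monomial of the standard torus is thereby one of the characters `χ_l`, so the
density of monomials there can be used for `ℝⁿ / Λ`. -/
theorem mFourier_toUnitTorus (m : Fin n → ℤ) (x : Space n) :
    UnitAddTorus.mFourier m (toUnitTorus b x) = chi (dualOfInt b m) (proj b x) := by
  change ∏ i, fourier (m i) ((b.equivFunL x i : ℝ) : UnitAddCircle) = _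
  rw [chi_proj]
  simp only [fourier_coe_apply, dualOfInt, sum_apply]
  rw [← Complex.exp_sum]
  congr 1
  push_cast
  rw [Finset.mul_sum]
  refine Finset.sum_congr rfl fun i _ => ?_
  simp
  ring

/-- A continuous periodic function whose Fourier coefficients vanish has zero `L²`-norm. -/
theorem integral_star_mul_self_eq_zero {f : Space n → ℂ} (hf : Continuous f)
    (hper : ∀ x, ∀ v ∈ lattice b, f (x + v) = f x)
    (h0 : ∀ l : dualLattice b, scalarCoeff l f = 0) :
    ∫ x in ZSpan.fundamentalDomain b, star (f x) * f x = 0 := by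
  have hT := isQuotientMap_toUnitTorus b
  let T : C(Space n, UnitAddTorus (Fin n)) := ⟨toUnitTorus b, hT.continuous⟩
  -- Points with the same image differ by a lattice vector, so the periodic `f` descends to the
  -- standard torus.
  have hlift : ∃ h : C(UnitAddTorus (Fin n), ℂ), ∀ x, h (toUnitTorus b x) = f x := by
    have hfac : Function.FactorsThrough (⟨f, hf⟩ : C(Space n, ℂ)) T := fun x y hxy => by
      have := hper y _ (sub_mem_lattice_of_toUnitTorus_eq hxy)
      rwa [add_sub_cancel] at this
    exact ⟨Topology.IsQuotientMap.lift (f := T) hT ⟨f, hf⟩ hfac,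
      fun x => DFunLike.congr_fun (Topology.IsQuotientMap.lift_comp (f := T) hT _ hfac) x⟩
  obtain ⟨h, hh⟩ := hlift
  obtain ⟨C, hC⟩ := bounded_of_periodic f hf b hper
  have hint : ∀ g : C(UnitAddTorus (Fin n), ℂ), IntegrableOn (fun x => g (toUnitTorus b x) * f x)
      (ZSpan.fundamentalDomain b) := fun g =>
    integrableOn_fundamentalDomain _ ((g.continuous.comp hT.continuous).mul hf) b
  let Φ₀ : C(UnitAddTorus (Fin n), ℂ) →ₗ[ℂ] ℂ :=
    { toFun := fun g => ∫ x in ZSpan.fundamentalDomain b, g (toUnitTorus b x) * f x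
      map_add' := fun g g' => by
        rw [← integral_add (hint g) (hint g')]
        simp only [ContinuousMap.add_apply, add_mul]
      map_smul' := fun c g => by
        simp only [ContinuousMap.smul_apply, smul_eq_mul, mul_assoc, RingHom.id_apply]
        rw [integral_const_mul] }
  let Φ : C(UnitAddTorus (Fin n), ℂ) →L[ℂ] ℂ :=
    Φ₀.mkContinuous (C * volume.real (ZSpan.fundamentalDomain b)) fun g => by
      have := norm_setIntegral_le_of_norm_le_const (μ := (volume : Measure (Space n)))
        (s := ZSpan.fundamentalDomain b) (f := fun x => g (toUnitTorus b x) * f x) (C := ‖g‖ * C)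
        (ZSpan.fundamentalDomain_isBounded b).measure_lt_top fun x _ => by
          rw [norm_mul]
          gcongr
          · exact g.norm_coe_le_norm _
          · exact hC x
      refine this.trans (le_of_eq ?_)
      ring
  -- The functional `g ↦ ∫ g f` is continuous for the sup norm and kills all monomials, whose span
  -- is dense.
  have hker : (LinearMap.ker Φ.toLinearMap) = ⊤ := by
    have hcl : IsClosed (LinearMap.ker Φ.toLinearMap : Set C(UnitAddTorus (Fin n), ℂ)) :=
      Φ.isClosed_ker
    rw [eq_top_iff, ← UnitAddTorus.span_mFourier_closure_eq_top]
    refine Submodule.topologicalClosure_minimal _ (Submodule.span_le.2 ?_) hcl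
    rintro _ ⟨m, rfl⟩
    -- The coefficient at `l` integrates against `χ_{-l}`, hence the sign.
    have h1 := h0 (-dualOfInt b m)
    rw [scalarCoeff, neg_neg] at h1
    have h2 := (mul_eq_zero.1 h1).resolve_left
      (inv_ne_zero (Complex.ofReal_ne_zero.2 (measureReal_fundamentalDomain_ne_zero b)))
    simp only [← mFourier_toUnitTorus] at h2
    exact h2
  have h3 : star h ∈ LinearMap.ker Φ.toLinearMap := hker ▸ Submodule.mem_top
  have h4 : ∫ x in ZSpan.fundamentalDomain b, (star h) (toUnitTorus b x) * f x = 0 := h3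
  simpa only [ContinuousMap.star_apply, hh] using h4

/-- A form is determined by its Fourier coefficients. -/
theorem form_eq_zero_of_coeff {ω : Form ℂ b p} (h : ∀ l, coeff l ω = 0) : ω = 0 := by
  apply form_eq_zero_of_l2Inner_self
  change ∫ x in ZSpan.fundamentalDomain b, altInner (pull ω x) (pull ω x) = 0
  simp only [altInner]
  have hI : ∀ v : Fin p → Space n,
      ∫ x in ZSpan.fundamentalDomain b, inner ℂ (pull ω x v) (pull ω x v) = 0 := by
    intro v
    rw [← integral_star_mul_self_eq_zero (continuous_pull_apply ω v)
      (fun x v hv => by rw [pull_add_mem ω x hv])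
      (fun l => by rw [← coeff_apply, h]; rfl)]
    congr 1
    funext x
    rw [RCLike.inner_apply', starRingEnd_apply]
  rw [integral_const_mul, integral_finsetSum]
  · simp only [hI, Finset.sum_const_zero, mul_zero]
  · intro I _
    exact integrableOn_fundamentalDomain _
      ((continuous_pull_apply ω _).inner (continuous_pull_apply ω _)) b

theorem form_eq_of_coeff {ω η : Form ℂ b p} (h : ∀ l, coeff l ω = coeff l η) : ω = η := by
  rw [← sub_eq_zero]
  refine form_eq_zero_of_coeff fun l => ?_
  rw [map_sub, h, sub_self]

theorem genHodge_chiMul (α β : ℝ) (l : dualLattice b) (φ : Alt ℂ n (p + 1)) :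
    genHodge ℂ b α β (p + 1) (chiMul l (p + 1) φ) = chiMul l (p + 1) (symbol α β l.1 p φ) := by
  classical
  refine form_eq_of_coeff fun m => ?_
  rw [coeff_genHodge, coeff_chiMul, coeff_chiMul]
  split_ifs with h
  · rw [h]
  · exact map_zero _

/-- A dual lattice vector is determined by the integers `l(bᵢ)`, and these are bounded by `r ‖bᵢ‖`.
-/
theorem finite_norm_le (b : Module.Basis (Fin n) ℝ (Space n)) (r : ℝ) :
    {l : dualLattice b | ‖l.1‖ ≤ r}.Finite := by
  have hv : ∀ (l : dualLattice b) (i : Fin n), ∃ m : ℤ, l.1 (b i) = m := fun l i =>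
    l.2 _ (Submodule.subset_span ⟨i, rfl⟩)
  choose k hk using hv
  have hinj : Function.Injective k := by
    intro l l' h
    refine Subtype.ext (ContinuousLinearMap.coe_injective (b.ext fun i => ?_))
    change l.1 (b i) = l'.1 (b i)
    rw [hk, hk, h]
  refine Set.Finite.of_finite_image (f := k) ?_ hinj.injOn
  refine (Set.Finite.pi' (t := fun i : Fin n => Set.Icc (-⌈r * ‖b i‖⌉) ⌈r * ‖b i‖⌉)
    fun i => Set.finite_Icc _ _).subset ?_
  rintro _ ⟨l, hl, rfl⟩ i
  rw [Set.mem_Icc, ← abs_le]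
  have h1 : |l.1 (b i)| ≤ r * ‖b i‖ :=
    (l.1.le_opNorm (b i)).trans (mul_le_mul_of_nonneg_right hl (norm_nonneg _))
  rw [hk, ← Int.cast_abs] at h1
  exact_mod_cast h1.trans (Int.le_ceil _)

end Completeness

end FlatTorus

namespace FlatTorus

/-! ### Eigenspaces, multiplicities and the direct sum decomposition -/

section Eigenspaces

variable {n p : ℕ} {b : Module.Basis (Fin n) ℝ (Space n)} {α β : ℝ}

/-- The eigenvalue equation is an equality of forms, which can be checked on Fourier coefficients.
-/
theorem mem_Eig_iff {z : ℂ} {ω : Form ℂ b (p + 1)} :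
    ω ∈ Eig ℂ b α β (p + 1) z ↔
      ∀ l, coeff l ω ∈ Module.End.eigenspace (symbol α β l.1 p) z := by
  simp only [Eig, Module.End.mem_eigenspace_iff, ← coeff_genHodge, ← map_smul]
  exact ⟨fun h l => by rw [h], form_eq_of_coeff⟩

theorem lam_eq_lam_iff {γ : ℝ} (hγ : 0 < γ) {l m : dualLattice b} :
    lam γ l = lam γ m ↔ ‖l.1‖ = ‖m.1‖ := by
  have h : 4 * Real.pi ^ 2 * γ ≠ 0 := by positivity
  rw [lam, lam, mul_right_inj' h, sq_eq_sq₀ (norm_nonneg _) (norm_nonneg _)]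

theorem finite_lam_eq (b : Module.Basis (Fin n) ℝ (Space n)) {γ : ℝ} (hγ : 0 < γ) (z : ℂ) :
    {l : dualLattice b | (lam γ l : ℂ) = z}.Finite := by
  rcases Set.eq_empty_or_nonempty {l : dualLattice b | (lam γ l : ℂ) = z} with h | ⟨m, hm⟩
  · rw [h]
    exact Set.finite_empty
  · refine (finite_norm_le b ‖m.1‖).subset fun l hl => ?_
    have h : (lam γ l : ℂ) = lam γ m := Eq.trans hl (Eq.symm hm)
    exact ((lam_eq_lam_iff hγ).1 (Complex.ofReal_injective h)).le

/-- The finite set of all `l` with `λ^l_α = z` or `λ^l_β = z`. -/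
noncomputable def frequencies (b : Module.Basis (Fin n) ℝ (Space n)) (hα : 0 < α) (hβ : 0 < β)
    (z : ℂ) : Finset (dualLattice b) :=
  ((finite_lam_eq b hα z).union (finite_lam_eq b hβ z)).toFinset

theorem mem_frequencies {hα : 0 < α} {hβ : 0 < β} {z : ℂ} {l : dualLattice b} :
    l ∈ frequencies b hα hβ z ↔ (lam α l : ℂ) = z ∨ (lam β l : ℂ) = z := by
  rw [frequencies, Set.Finite.mem_toFinset]
  rfl

theorem eigenspace_symbol_eq_bot {hα : 0 < α} {hβ : 0 < β} {z : ℂ} {l : dualLattice b}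
    (hl : l ∉ frequencies b hα hβ z) : Module.End.eigenspace (symbol α β l.1 p) z = ⊥ := by
  rw [mem_frequencies, not_or] at hl
  simp only [lam] at hl
  rw [eigenspace_symbol, if_neg hl.1, if_neg hl.2, sup_bot_eq]

open scoped Classical in
theorem coeff_sum_chiMul (S : Finset (dualLattice b)) (φ : dualLattice b → Alt ℂ n p)
    (m : dualLattice b) :
    coeff m (∑ l ∈ S, chiMul l p (φ l)) = if m ∈ S then φ m else 0 := by
  rw [map_sum]
  simp only [coeff_chiMul]
  exact Finset.sum_ite_eq S m φ

/-- The Fourier expansion of an eigenform. -/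
theorem eq_sum_of_mem_Eig (hα : 0 < α) (hβ : 0 < β) {z : ℂ} {ω : Form ℂ b (p + 1)}
    (hω : ω ∈ Eig ℂ b α β (p + 1) z) :
    ω = ∑ l ∈ frequencies b hα hβ z, chiMul l (p + 1) (coeff l ω) := by
  classical
  refine form_eq_of_coeff fun m => ?_
  rw [coeff_sum_chiMul]
  split_ifs with h
  · rfl
  · have := mem_Eig_iff.1 hω m
    rwa [eigenspace_symbol_eq_bot h, Submodule.mem_bot] at this

/-- The Fourier coefficients of eigenforms. -/
noncomputable def eigCoeff (b : Module.Basis (Fin n) ℝ (Space n)) (hα : 0 < α) (hβ : 0 < β)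
    (p : ℕ) (z : ℂ) : Eig ℂ b α β (p + 1) z →ₗ[ℂ]
      ∀ l : frequencies b hα hβ z, Module.End.eigenspace (symbol α β l.1.1 p) z :=
  LinearMap.pi fun l => ((coeff l.1).comp (Submodule.subtype _)).codRestrict _
    fun ω => mem_Eig_iff.1 ω.2 l.1

/-- Injectivity is the finite Fourier expansion. For surjectivity, prescribed eigenvectors are
extended by zero to all of `Λ*` and summed; the finite sum is smooth and has these coefficients. -/
theorem bijective_eigCoeff (hα : 0 < α) (hβ : 0 < β) (z : ℂ) :
    Function.Bijective (eigCoeff b hα hβ p z) := by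
  classical
  constructor
  · rw [injective_iff_map_eq_zero]
    intro ω hω
    apply Subtype.ext
    rw [eq_sum_of_mem_Eig hα hβ ω.2]
    refine Finset.sum_eq_zero fun l hl => ?_
    have h : coeff l ω.1 = 0 := congrArg Subtype.val (congrFun hω ⟨l, hl⟩)
    rw [h, map_zero]
  · intro η
    let φ : dualLattice b → Alt ℂ n (p + 1) := fun l =>
      if h : l ∈ frequencies b hα hβ z then (η ⟨l, h⟩).1 else 0
    have h : ∀ m, coeff m (∑ l ∈ frequencies b hα hβ z, chiMul l (p + 1) (φ l)) = φ m := by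
      intro m
      rw [coeff_sum_chiMul]
      split_ifs with hm
      · rfl
      · exact (show φ m = 0 from dif_neg hm).symm
    refine ⟨⟨∑ l ∈ frequencies b hα hβ z, chiMul l (p + 1) (φ l), mem_Eig_iff.2 fun m => ?_⟩, ?_⟩
    · rw [h]
      by_cases hm : m ∈ frequencies b hα hβ z
      · rw [show φ m = _ from dif_pos hm]
        exact (η ⟨m, hm⟩).2
      · rw [show φ m = _ from dif_neg hm]
        exact Submodule.zero_mem _
    · funext l
      apply Subtype.ext
      exact (h l.1).trans (dif_pos l.2)

theorem finiteDimensional_Eig (hα : 0 < α) (hβ : 0 < β) (z : ℂ) :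
    FiniteDimensional ℂ (Eig ℂ b α β (p + 1) z) :=
  FiniteDimensional.of_injective (eigCoeff b hα hβ p z) (bijective_eigCoeff hα hβ z).1

theorem weightedSingle_apply (x z : ℂ) (m : ℕ) :
    weightedSingle x m z = if x = z then m else 0 := by
  rw [weightedSingle, Pi.single_apply]
  simp only [eq_comm]

/-- Any finite set containing the support may be used, so that the unions for `α` and `β` become
sums over the same set. -/
theorem weightedUnion_apply {γ : ℝ} {z : ℂ} {S : Finset (dualLattice b)}
    (hS : ∀ l : dualLattice b, (lam γ l : ℂ) = z → l ∈ S) (c : ℕ) :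
    weightedUnion (fun l : dualLattice b => weightedSingle (lam γ l) c) z =
      ∑ l ∈ S, if (lam γ l : ℂ) = z then c else 0 := by
  rw [weightedUnion, finsum_eq_sum_of_support_subset (s := S)]
  · refine Finset.sum_congr rfl fun l _ => ?_
    exact weightedSingle_apply _ _ _
  · intro l hl
    by_contra h
    refine hl ?_
    exact (weightedSingle_apply _ _ _).trans (if_neg fun h' => h (hS l h'))

theorem spec_eq (hn : 1 ≤ n) (hα : 0 < α) (hβ : 0 < β) :
    spec b α β (p + 1) =
      weightedUnion (fun l : dualLattice b => weightedSingle (lam α l) ((n - 1).choose p)) +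
      weightedUnion (fun l : dualLattice b => weightedSingle (lam β l) ((n - 1).choose (p + 1))) := by
  classical
  funext z
  rw [Pi.add_apply,
    weightedUnion_apply (S := frequencies b hα hβ z) fun l h => mem_frequencies.2 (Or.inl h),
    weightedUnion_apply (S := frequencies b hα hβ z) fun l h => mem_frequencies.2 (Or.inr h),
    ← Finset.sum_add_distrib, spec,
    (LinearEquiv.ofBijective _ (bijective_eigCoeff hα hβ z)).finrank_eq, Module.finrank_pi_fintype,
    ← Finset.sum_coe_sort (frequencies b hα hβ z)]
  refine Finset.sum_congr rfl fun l _ => ?_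
  rw [finrank_eigenspace_symbol hn]
  rfl

theorem iSupIndep_of_disjoint {R M ι : Type*} [Ring R] [AddCommGroup M] [Module R M]
    {A B : ι → Submodule R M} (h : ∀ i, Disjoint (A i) (B i)) (h' : ∀ i j, j ≠ i → A j ≤ B i) :
    iSupIndep A :=
  fun i => (h i).mono_right (iSup₂_le fun j hj => h' i j hj)

theorem disjoint_map_chiMul_comap_coeff (l : dualLattice b) {A B : Submodule ℂ (Alt ℂ n p)}
    (h : Disjoint A B) : Disjoint (A.map (chiMul l p)) (B.comap (coeff l)) := by
  classical
  rw [Submodule.disjoint_def]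
  rintro _ ⟨φ, hφ, rfl⟩ h2
  rw [Submodule.mem_comap, coeff_chiMul, if_pos rfl] at h2
  rw [Submodule.disjoint_def.1 h φ hφ h2, map_zero]

theorem map_chiMul_le_comap_coeff {l m : dualLattice b} {A B : Submodule ℂ (Alt ℂ n p)}
    (h : m = l → A ≤ B) : A.map (chiMul l p) ≤ B.comap (coeff m) := by
  classical
  rintro _ ⟨φ, hφ, rfl⟩
  rw [Submodule.mem_comap, coeff_chiMul]
  split_ifs with hm
  · exact h hm hφ
  · exact B.zero_mem

/-- For `V_l`, the other members all lie in the space of forms whose `l`-th coefficient is killed by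
`l^♯ ⌟ ·`: this coefficient is zero at other frequencies, and in `W_l` it is in the kernel by
definition. That space meets `V_l` trivially. For `W_l` the roles are exchanged. The same `l` may
thus occur in both halves of the family. -/
theorem iSupIndep_eigFamily (b : Module.Basis (Fin n) ℝ (Space n)) (p : ℕ) (r s : ℝ) :
    iSupIndep (eigFamily b (p + 1) r s) := by
  refine iSupIndep_of_disjoint (B := Sum.elim
    (fun l => (LinearMap.ker (contract (sharp l.1.1) p)).comap (coeff l.1))
    (fun l => (LinearMap.range (wedge l.1.1 p)).comap (coeff l.1))) ?_ ?_
  · rintro (l | l)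
    · exact disjoint_map_chiMul_comap_coeff _ (isCompl_range_wedge_ker_contract _).disjoint
    · exact disjoint_map_chiMul_comap_coeff _ (isCompl_range_wedge_ker_contract _).disjoint.symm
  · rintro (l | l) (m | m) hne
    · exact map_chiMul_le_comap_coeff fun h => (hne (congrArg Sum.inl (Subtype.ext h.symm))).elim
    · exact map_chiMul_le_comap_coeff fun h => by rw [h]
    · exact map_chiMul_le_comap_coeff fun h => by rw [h]
    · exact map_chiMul_le_comap_coeff fun h => (hne (congrArg Sum.inr (Subtype.ext h.symm))).elim

/-- Each term of the finite Fourier expansion splits into a `V_l` and a `W_l` part, and a part can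
be nonzero only if its scalar is `z`. Stated with abstract radii, this covers both `z = λ^k_α` and
`z = λ^k_β`. -/
theorem isDirectSum_Eig (hα : 0 < α) (hβ : 0 < β) {z : ℂ} {r s : ℝ}
    (hr : ∀ l : dualLattice b, (lam α l : ℂ) = z ↔ ‖l.1‖ = r)
    (hs : ∀ l : dualLattice b, (lam β l : ℂ) = z ↔ ‖l.1‖ = s) :
    IsDirectSum (Eig ℂ b α β (p + 1) z) (eigFamily b (p + 1) r s) := by
  classical
  refine ⟨iSupIndep_eigFamily b p r s, le_antisymm ?_ (iSup_le ?_)⟩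
  · intro ω hω
    rw [eq_sum_of_mem_Eig hα hβ hω]
    refine Submodule.sum_mem _ fun l _ => ?_
    have h := mem_Eig_iff.1 hω l
    rw [eigenspace_symbol] at h
    obtain ⟨η, hη, θ, hθ, h⟩ := Submodule.mem_sup.1 h
    rw [← h, map_add]
    refine Submodule.add_mem _ ?_ ?_
    · split_ifs at hη with hl
      · exact Submodule.mem_iSup_of_mem (Sum.inl ⟨l, (hr l).1 hl⟩) ⟨η, hη, rfl⟩
      · rw [(Submodule.mem_bot ℂ).1 hη, map_zero]
        exact Submodule.zero_mem _
    · split_ifs at hθ with hl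
      · exact Submodule.mem_iSup_of_mem (Sum.inr ⟨l, (hs l).1 hl⟩) ⟨θ, hθ, rfl⟩
      · rw [(Submodule.mem_bot ℂ).1 hθ, map_zero]
        exact Submodule.zero_mem _
  · rintro (l | l)
    · rintro _ ⟨η, hη, rfl⟩
      rw [Module.End.mem_eigenspace_iff, genHodge_chiMul, symbol_of_mem_range_wedge hη, map_smul]
      congr 1
      exact (hr l).2 l.2
    · rintro _ ⟨η, hη, rfl⟩
      rw [Module.End.mem_eigenspace_iff, genHodge_chiMul, symbol_of_mem_ker_contract hη, map_smul]
      congr 1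
      exact (hs l).2 l.2

theorem lam_eq_lam_iff_norm_eq_sqrt {γ γ' : ℝ} (hγ : 0 < γ) (hγ' : 0 < γ') {l k : dualLattice b} :
    lam γ' l = lam γ k ↔ ‖l.1‖ = √(γ / γ') * ‖k.1‖ := by
  have h : 4 * Real.pi ^ 2 * γ' ≠ 0 := by positivity
  have h1 : lam γ k = 4 * Real.pi ^ 2 * γ' * (√(γ / γ') * ‖k.1‖) ^ 2 := by
    rw [lam, mul_pow, Real.sq_sqrt (by positivity)]
    field_simp
  rw [h1, lam, mul_right_inj' h, sq_eq_sq₀ (norm_nonneg _) (by positivity)]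

end Eigenspaces

end FlatTorus

namespace FlatTorus

/-! ### Real-valued forms -/

section RealForms

variable {𝕜 𝕜' : Type} [RCLike 𝕜] [RCLike 𝕜'] {n p : ℕ} {b : Module.Basis (Fin n) ℝ (Space n)}

/-- The map on forms induced by an `ℝ`-linear map on the values. -/
noncomputable def mapForm (L : 𝕜 →L[ℝ] 𝕜') (ω : Form 𝕜 b p) : Form 𝕜' b p :=
  ofPeriodic (fun x => L.compContinuousAlternatingMap (pull ω x))
    ((ContinuousLinearMap.compContinuousAlternatingMapCLM ℝ (Space n) 𝕜 𝕜' (Fin p) L).contDiff.comp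
      (contDiff_pull ω))
    (fun x v hv => by rw [pull_add_mem ω x hv])

theorem pull_mapForm_apply (L : 𝕜 →L[ℝ] 𝕜') (ω : Form 𝕜 b p) (x : Space n)
    (v : Fin p → Space n) : pull (mapForm L ω) x v = L (pull ω x v) := rfl

theorem form_ext_apply {ω η : Form 𝕜 b p} (h : ∀ x v, pull ω x v = pull η x v) : ω = η := by
  ext1 x
  ext v
  exact h x v

theorem fderiv_pull_mapForm_apply (L : 𝕜 →L[ℝ] 𝕜') (ω : Form 𝕜 b p) (x w : Space n)
    (v : Fin p → Space n) :
    fderiv ℝ (pull (mapForm L ω)) x w v = L (fderiv ℝ (pull ω) x w v) := by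
  have h := (ContinuousLinearMap.compContinuousAlternatingMapCLM ℝ (Space n) 𝕜 𝕜' (Fin p)
    L).hasFDerivAt.comp x ((contDiff_pull ω).differentiable (by simp) x).hasFDerivAt
  have h' : HasFDerivAt (pull (mapForm L ω)) _ x := h
  rw [h'.fderiv]
  rfl

theorem extD_mapForm (L : 𝕜 →L[ℝ] 𝕜') (ω : Form 𝕜 b p) :
    extD (mapForm L ω) = mapForm L (extD ω) := by
  refine form_ext_apply fun x v => ?_
  rw [pull_mapForm_apply, pull_extD, pull_extD, extDeriv, extDeriv,
    ContinuousAlternatingMap.alternatizeUncurryFin_apply,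
    ContinuousAlternatingMap.alternatizeUncurryFin_apply, map_sum]
  refine Finset.sum_congr rfl fun i _ => ?_
  rw [fderiv_pull_mapForm_apply, map_zsmul]

/-- The explicit formula for `δ` is real-linear in the values, whereas its definition as an adjoint
depends on the scalar product over `𝕜`. -/
theorem codiff_mapForm (L : 𝕜 →L[ℝ] 𝕜') (ω : Form 𝕜 b (p + 1)) :
    codiff (mapForm L ω) = mapForm L (codiff ω) := by
  rw [codiff_eq_divLin, codiff_eq_divLin]
  refine form_ext_apply fun x v => ?_
  rw [pull_mapForm_apply, pull_divLin, pull_divLin, divFun, divFun,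
    ContinuousAlternatingMap.neg_apply, ContinuousAlternatingMap.neg_apply, map_neg,
    ContinuousAlternatingMap.sum_apply, ContinuousAlternatingMap.sum_apply, map_sum]
  congr 1
  exact Finset.sum_congr rfl fun i _ => fderiv_pull_mapForm_apply L ω x _ _

theorem mapForm_ofReal_smul (L : 𝕜 →L[ℝ] 𝕜') (c : ℝ) (ω : Form 𝕜 b p) :
    mapForm L ((c : 𝕜) • ω) = (c : 𝕜') • mapForm L ω := by
  refine form_ext_apply fun x v => ?_
  change L ((c : 𝕜) • pull ω x v) = (c : 𝕜') • L (pull ω x v)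
  rw [smul_eq_mul, smul_eq_mul, ← RCLike.real_smul_eq_coe_mul, ← RCLike.real_smul_eq_coe_mul,
    map_smul]

theorem mapForm_add (L : 𝕜 →L[ℝ] 𝕜') (ω η : Form 𝕜 b p) :
    mapForm L (ω + η) = mapForm L ω + mapForm L η :=
  form_ext_apply fun x v => map_add L (pull ω x v) (pull η x v)

/-- Since `α` and `β` are real, only real linearity of `L` is needed. It is applied to real part,
imaginary part, the inclusion of `ℝ` and multiplication by `i`. -/
theorem genHodge_mapForm (L : 𝕜 →L[ℝ] 𝕜') (α β : ℝ) (ω : Form 𝕜 b (p + 1)) :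
    genHodge 𝕜' b α β (p + 1) (mapForm L ω) = mapForm L (genHodge 𝕜 b α β (p + 1) ω) := by
  change (α : 𝕜') • extD (codiff (mapForm L ω)) + (β : 𝕜') • codiff (extD (mapForm L ω)) =
    mapForm L ((α : 𝕜) • extD (codiff ω) + (β : 𝕜) • codiff (extD ω))
  rw [mapForm_add, mapForm_ofReal_smul, mapForm_ofReal_smul, codiff_mapForm, extD_mapForm,
    extD_mapForm, codiff_mapForm]

theorem mapForm_mem_Eig (L : 𝕜 →L[ℝ] 𝕜') {α β z : ℝ} {ω : Form 𝕜 b (p + 1)}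
    (h : ω ∈ Eig 𝕜 b α β (p + 1) (z : 𝕜)) : mapForm L ω ∈ Eig 𝕜' b α β (p + 1) (z : 𝕜') := by
  rw [Module.End.mem_eigenspace_iff] at h ⊢
  rw [genHodge_mapForm, h, mapForm_ofReal_smul]

/-- Complex eigenforms are pairs of real eigenforms. -/
noncomputable def eigRealEquiv (b : Module.Basis (Fin n) ℝ (Space n)) (α β : ℝ) (p : ℕ) (z : ℝ) :
    Eig ℂ b α β (p + 1) (z : ℂ) ≃ₗ[ℝ] Eig ℝ b α β (p + 1) z × Eig ℝ b α β (p + 1) z where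
  toFun ω := (⟨mapForm Complex.reCLM ω.1, mapForm_mem_Eig Complex.reCLM ω.2⟩,
    ⟨mapForm Complex.imCLM ω.1, mapForm_mem_Eig Complex.imCLM ω.2⟩)
  map_add' ω η := by
    ext1 <;> exact Subtype.ext (mapForm_add _ _ _)
  map_smul' c ω := by
    ext1 <;> exact Subtype.ext (mapForm_ofReal_smul _ _ _)
  invFun η := ⟨mapForm Complex.ofRealCLM η.1.1 +
      mapForm (Complex.ofRealCLM.smulRight Complex.I) η.2.1,
    Submodule.add_mem _ (mapForm_mem_Eig Complex.ofRealCLM η.1.2) (mapForm_mem_Eig _ η.2.2)⟩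
  left_inv ω := by
    refine Subtype.ext (form_ext_apply fun x v => ?_)
    exact Complex.re_add_im (pull ω.1 x v)
  right_inv η := by
    ext1
    · refine Subtype.ext (form_ext_apply fun x v => ?_)
      change ((pull η.1.1 x v : ℂ) + (pull η.2.1 x v : ℂ) * Complex.I).re = pull η.1.1 x v
      simp
    · refine Subtype.ext (form_ext_apply fun x v => ?_)
      change ((pull η.1.1 x v : ℂ) + (pull η.2.1 x v : ℂ) * Complex.I).im = pull η.2.1 x v
      simp

variable {α β : ℝ}

theorem finiteDimensional_Eig_real (hα : 0 < α) (hβ : 0 < β) (z : ℝ) :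
    FiniteDimensional ℝ (Eig ℝ b α β (p + 1) z) := by
  have := finiteDimensional_Eig (b := b) (p := p) hα hβ z
  have := FiniteDimensional.complexToReal (Eig ℂ b α β (p + 1) (z : ℂ))
  exact Module.Finite.of_surjective
    (LinearMap.fst ℝ (Eig ℝ b α β (p + 1) z) (Eig ℝ b α β (p + 1) z) ∘ₗ
      (eigRealEquiv b α β p z).toLinearMap)
    (Prod.fst_surjective.comp (eigRealEquiv b α β p z).surjective)

theorem finrank_Eig_real (hα : 0 < α) (hβ : 0 < β) (z : ℝ) :
    Module.finrank ℝ (Eig ℝ b α β (p + 1) z) = spec b α β (p + 1) z := by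
  have := finiteDimensional_Eig_real (b := b) (p := p) hα hβ z
  have h := (eigRealEquiv b α β p z).finrank_eq
  rw [Module.finrank_prod, finrank_real_of_complex] at h
  rw [spec]
  -- Both sides are doubled in `h`: two copies of the real eigenspace, and twice the complex
  -- dimension.
  omega

end RealForms

end FlatTorus

open FlatTorus in
theorem theorem3 (n : ℕ) (b : Module.Basis (Fin n) ℝ (Space n)) (α β : ℝ) (hα : 0 < α) (hβ : 0 < β)
    (p : ℕ) (hp : 1 ≤ p) (hpn : p ≤ n) :
    -- the weighted unions make sense and all eigenspaces are finite-dimensional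
    (∀ r : ℝ, {l : dualLattice b | ‖l.1‖ = r}.Finite) ∧
    (∀ z : ℂ, FiniteDimensional ℂ (Eig ℂ b α β p z)) ∧
    -- the spectrum
    spec b α β p =
      weightedUnion (fun l : dualLattice b => weightedSingle (lam α l) ((n - 1).choose (p - 1))) +
      weightedUnion (fun l : dualLattice b => weightedSingle (lam β l) ((n - 1).choose p)) ∧
    -- the multiplicities are the same for real-valued forms
    (∀ z : ℝ, FiniteDimensional ℝ (Eig ℝ b α β p z) ∧
      Module.finrank ℝ (Eig ℝ b α β p z) = spec b α β p z) ∧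
    -- the eigenspaces
    ∀ k : dualLattice b,
      IsDirectSum (Eig ℂ b α β p (lam α k)) (eigFamily b p ‖k.1‖ (√(α / β) * ‖k.1‖)) ∧
      IsDirectSum (Eig ℂ b α β p (lam β k)) (eigFamily b p (√(β / α) * ‖k.1‖) ‖k.1‖) := by
  -- With `p = q + 1` the operator has its `dδ` term, and `p - 1` becomes `q`.
  obtain ⟨q, rfl⟩ := Nat.exists_eq_add_of_le' hp
  refine ⟨fun r => (finite_norm_le b r).subset fun l hl => le_of_eq hl,
    finiteDimensional_Eig hα hβ, spec_eq (hp.trans hpn) hα hβ,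
    fun z => ⟨finiteDimensional_Eig_real hα hβ z, finrank_Eig_real hα hβ z⟩, fun k => ⟨?_, ?_⟩⟩
  · exact isDirectSum_Eig hα hβ
      (fun l => Complex.ofReal_inj.trans (lam_eq_lam_iff hα))
      (fun l => Complex.ofReal_inj.trans (lam_eq_lam_iff_norm_eq_sqrt hα hβ))
  · exact isDirectSum_Eig hα hβ
      (fun l => Complex.ofReal_inj.trans (lam_eq_lam_iff_norm_eq_sqrt hβ hα))
      (fun l => Complex.ofReal_inj.trans (lam_eq_lam_iff hβ))
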